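/- Let $\alpha\in(0,1]$ and $\beta\in\mathbb R$ with $\beta\ge 1-\frac1\alpha$, and put $\beta_\alpha=\beta+\frac1\alpha-1$, $\bar\beta_\alpha=\alpha\beta_\alpha=\alpha\beta-\alpha+1\ (\ge 0)$. For $x>0$ and $n\in\mathbb N$ let $$\mathbf e_{\alpha,\beta}(x)=\frac{x^{\beta+\frac1\alpha-1}e^{-x^{1/\alpha}}}{\Gamma(\alpha\beta+1)},\qquad \mathcal R_n(x)=\frac{(-1)^n}{n!\,\mathbf e_{\alpha,\beta}(x)}\frac{d^n}{dx^n}\bigl(x^n\mathbf e_{\alpha,\beta}(x)\bigr),\qquad \mathcal W_n(x)=\mathcal R_n(x)\,\mathbf e_{\alpha,\beta}(x).$$ Write $$\overline C_\alpha=\alpha^\alpha\frac{\cos^{\alpha+1}(\frac\pi2\alpha)}{\sin^\alpha(\frac\pi2\alpha)},\qquad \overline B_\alpha=\alpha^\alpha\frac{\csc\bigl(\frac{\pi}{2(1+\alpha)}\bigr)}{\sin^\alpha\bigl(\frac{\pi\alpha}{2(1+\alpha)}\bigr)},\qquad \overline A_\alpha=(1+\alpha)^{\alpha+1}.$$ Then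 $\overline C_\alpha\le\overline B_\alpha\le\overline A_\alpha$ for all $\alpha\in(0,1]$. Moreover, for fixed $\beta$ (all constants $K$ and thresholds $n_0\ge1$ below may depend on $\beta$, and $\alpha$ ranges only over values with $\beta\ge1-\frac1\alpha$), the following hold. 1. Let $\alpha\in(0,1)$, $a>-\beta_\alpha$ and $0<\epsilon<\alpha$. There are $K>0$ and $n_0$, depending only on $\alpha,\beta,a,\epsilon$, such that for all $n\ge n_0$ and all $x>0$ $$|\mathcal W_n(x)|\le K\,n^{\frac32-a}\csc\bigl((\alpha-\epsilon)\tfrac\pi2\bigr)^n x^{-a}.$$ 2. For each $\alpha\in(0,1]$ the function $$\bar\kappa_\alpha(\theta)=\alpha^\alpha\,\frac{\sin((1+\alpha)\theta)}{\sin\theta}\left(\frac{\sin((1+\alpha)\theta)}{\sin(\alpha\theta)}\right)^{\alpha}$$ is strictly decreasing on $(0,\frac\pi2]$, with $\bar\kappa_\alpha(0+)=\overline A_\alpha$, $\bar\kappa_\alpha\bigl(\frac{\pi}{2(1+\alpha)}\bigr)=\overline B_\alpha$ and $\bar\kappa_\alpha(\frac\pi2)=\overline C_\alpha$. For all $\bar\alpha\in(0,1)$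 and $\bar\theta\in(0,\frac\pi2)$ there is $K=K(\bar\theta,\bar\alpha)>0$ such that for all $\alpha\in(\bar\alpha,1]$, $\theta\in(0,\bar\theta)$, $n\ge1$, with $x=\bar\kappa_\alpha(\theta)n^\alpha$, $$|\mathcal W_n(x)|\le K\left(\cos\theta\Bigl(\frac{\sin\theta}{\sin((1+\alpha)\theta)}\Bigr)^{\frac1\alpha}\right)^{\bar\beta_\alpha+\frac12}x^{\beta_\alpha}\exp\left(n\Bigl(-\alpha\frac{\sin((1+\alpha)\theta)\cos\theta}{\sin(\alpha\theta)}+\ln\frac{\sin\theta}{\sin(\alpha\theta)}\Bigr)\right).$$ 3. For all $\bar\alpha\in(0,1)$ and $\epsilon>0$ there are $n_0$ and $K>0$ such that for all $\alpha\in[\bar\alpha,1]$ with $\epsilon<\overline B_\alpha-\overline C_\alpha$, all $n\ge n_0$ and all $x\in\bigl((\overline C_\alpha+\epsilon)n^\alpha,\overline A_\alpha n^\alpha\bigr)$ $$|\mathcal W_n(x)|\le K\,x^{\beta_\alpha}e^{-\frac12x^{1/\alpha}}\exp\left(n\Bigl(-\ln\alpha+\tfrac12(1+\alpha)^{\frac{1+\alpha}{\alpha}}-1-\alpha\Bigr)\right).$$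 Also, there are $n_0$ and $K>0$ such that the same bound holds for all $\alpha\in(0,1]$, all $n\ge n_0$ and all $x\in(\overline B_\alpha n^\alpha,\overline A_\alpha n^\alpha)$. 4. For $\alpha\in(0,1)$ put $E_\alpha=[(\alpha+1)^{-1/\alpha},1)$ and, for $\eta<1$, $$H_{\alpha,\eta}=\begin{cases}\eta(1+\alpha)^{\frac{\alpha+1}{\alpha}}-(\alpha+1)-\ln\alpha,&\eta\notin E_\alpha,\\ -\ln(\eta^{-\alpha}-1),&\eta\in E_\alpha.\end{cases}$$ For every $\eta<1$ there is $K>0$ such that for all $\alpha\in(0,1)$, $n\ge1$ and $x\ge\overline A_\alpha n^\alpha$ $$|\mathcal W_n(x)|\le K\,\alpha^{-\frac52}\,x^{\beta_\alpha}e^{-\eta x^{1/\alpha}}e^{nH_{\alpha,\eta}}.$$ Moreover $[\frac12,1)\subset E_\alpha$ for all $\alpha\in(0,1)$; for $\alpha,\eta\in(0,1)$ one has $H_{\alpha,\eta}=\max\bigl\{\eta(1+\alpha)^{\frac{\alpha+1}{\alpha}}-(\alpha+1)-\ln\alpha,\ -\ln(\eta^{-\alpha}-1)\bigr\}$; and $\lim_{\alpha\uparrow1}\lim_{\eta\to\frac12}H_{\alpha,\eta}=0$.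 -/

import Mathlib

open Real Set Filter Topology

noncomputable section

namespace GaussLaguerre

/-- The exponent `β_α = β + 1/α - 1`. -/
def betaIdx (α β : ℝ) : ℝ := β + 1 / α - 1

/-- `α β_α = α β - α + 1`, nonnegative as soon as `β ≥ 1 - 1/α`. -/
def betaBar (α β : ℝ) : ℝ := α * β - α + 1

/-- The weight `e_{α,β}(x) = x^(β + 1/α - 1) exp(-x^(1/α)) / Γ(α β + 1)`, for `x > 0`. -/
def weight (α β x : ℝ) : ℝ :=
  x ^ (β + 1 / α - 1) * exp (-x ^ (1 / α)) / Gamma (α * β + 1)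

/-- The co-eigenfunction `R_n`, by the weighted Rodrigues formula, for `x > 0`. -/
def coEigen (α β : ℝ) (n : ℕ) (x : ℝ) : ℝ :=
  (-1) ^ n / ((n.factorial : ℝ) * weight α β x) *
    iteratedDeriv n (fun y : ℝ => y ^ n * weight α β y) x

/-- `W_n(x) = R_n(x) e_{α,β}(x)`. -/
def W (α β : ℝ) (n : ℕ) (x : ℝ) : ℝ := coEigen α β n x * weight α β x

/-- The constant `C̄_α`. -/
def Cbar (α : ℝ) : ℝ :=
  α ^ α * (cos (π / 2 * α) ^ (α + 1) / sin (π / 2 * α) ^ α)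

/-- The constant `B̄_α` (with `csc = 1 / sin`). -/
def Bbar (α : ℝ) : ℝ :=
  α ^ α * ((1 / sin (π / (2 * (1 + α)))) / sin (π * α / (2 * (1 + α))) ^ α)

/-- The constant `Ā_α`. -/
def Abar (α : ℝ) : ℝ := (1 + α) ^ (α + 1)

/-- The function `κ̄_α(θ)`, for `0 < θ ≤ π/2`. -/
def kappaBar (α θ : ℝ) : ℝ :=
  α ^ α * (sin ((1 + α) * θ) / sin θ) * (sin ((1 + α) * θ) / sin (α * θ)) ^ α

/-- The interval `E_α = [(α + 1)^(-1/α), 1)`. -/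
def E (α : ℝ) : Set ℝ := Ico ((α + 1) ^ (-(1 / α))) 1

open Classical in
/-- The exponent `H_{α,η}`, for `η < 1`. -/
def H (α η : ℝ) : ℝ :=
  if η ∈ E α then -log (η ^ (-α) - 1)
  else η * (1 + α) ^ ((α + 1) / α) - (α + 1) - log α

end GaussLaguerre

end

noncomputable section

namespace GaussLaguerre

/-! Up to sign, `W_n(x)` is the `n`-th Taylor coefficient at `x` of `w^n e(w)`, where `e` is the
weight. Cauchy's formula and the substitution `w = x v^α` make it an integral around `v = 1` in the
right half-plane, with integrand of modulus `x^{β_α} (α/Γ(αβ+1)) |v|^{αβ-α} e^{-x^{1/α} Re v} /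
g(v)^{n+1}`, where `g(v) = |1 - v^{-α}|` is `gap` (`abs_W_le_of_rect`).

The contour is a rectangle whose left side lies on a line `Re v = σ` with `0 < σ < 1`. If `x^{1/α} ≥
c n` and the rectangle is large, the other three sides cost nothing: moving right, the exponential
gains at least what `g^{-n}` can lose (`le_gap_mul_exp_of_boundary`). Hence `|W_n(x)| ≤ K x^{β_α}
e^{-σ x^{1/α}} m^{-n}` for any lower bound `m` of `g` on the line, with `K` uniform in `α`
(`exists_abs_W_le`).

It remains to minimise `g` on vertical lines. At the point of argument `φ`, the sign of the
derivative of `g²` is decided by comparing `σ^{-α}` with `saddleRatio α φ`, which is nondecreasing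
in `φ` and at least `1 + α`. So if `σ^{-α} ≤ 1 + α` the minimum is `σ^{-α} - 1`, on the real axis;
if `σ^{-α} = saddleRatio α θ` it is `sin(αθ)/sin θ`, at angle `θ`.

The saddle choice of `σ` gives the bound at `x = κ̄_α(θ) n^α`. The borderline `σ = (1+α)^{-1/α}`,
with `m = α`, gives the middle range, and also the outer range for `η ∉ E_α`; for `η ∈ E_α` one
takes `σ = η`. The bound for all `x > 0` uses one line far enough left that `g` exceeds the sine of
a suitable angle on the whole contour. The claims on `κ̄_α` and `H` are real calculus, from
concavity of sine and Bernoulli's inequality. -/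

/-! ### Contour integrals over rectangles and Cauchy's formula. -/

/-- The integral of `f` along the positively oriented boundary of `[a, b] × [-T, T]`. -/
def rectIntegral (f : ℂ → ℂ) (a b T : ℝ) : ℂ :=
  (∫ x : ℝ in a..b, f (x + (-T : ℝ) * Complex.I)) - (∫ x : ℝ in a..b, f (x + T * Complex.I)) +
    Complex.I * (∫ y : ℝ in (-T)..T, f (b + y * Complex.I)) -
    Complex.I * (∫ y : ℝ in (-T)..T, f (a + y * Complex.I))

/-- The right half-plane without the point `1`. -/
def puncturedHalfPlane : Set ℂ := {v | 0 < v.re ∧ v ≠ 1}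

theorem mem_punctured_of_im_ne {v : ℂ} (h : 0 < v.re) (h' : v.im ≠ 0) :
    v ∈ puncturedHalfPlane :=
  ⟨h, fun e => h' (by simp [e])⟩

theorem mem_punctured_of_re_ne {v : ℂ} (h : 0 < v.re) (h' : v.re ≠ 1) :
    v ∈ puncturedHalfPlane :=
  ⟨h, fun e => h' (by simp [e])⟩

section Rect

variable {a b T : ℝ} {f g F : ℂ → ℂ}

theorem horizontal_mem (ha : 0 < a) (hab : a ≤ b) {t : ℝ} (ht : t ≠ 0) {x : ℝ}
    (hx : x ∈ uIcc a b) : (x + t * Complex.I : ℂ) ∈ puncturedHalfPlane := by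
  rw [uIcc_of_le hab] at hx
  exact mem_punctured_of_im_ne (by simpa using ha.trans_le hx.1) (by simpa using ht)

theorem vertical_mem {s : ℝ} (hs : 0 < s) (hs1 : s ≠ 1) (y : ℝ) :
    (s + y * Complex.I : ℂ) ∈ puncturedHalfPlane :=
  mem_punctured_of_re_ne (by simpa using hs) (by simpa using hs1)

theorem horizontal_integrable (hf : ContinuousOn f puncturedHalfPlane) (ha : 0 < a) (hab : a ≤ b)
    {t : ℝ} (ht : t ≠ 0) :
    IntervalIntegrable (fun x : ℝ => f (x + t * Complex.I)) MeasureTheory.volume a b :=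
  ContinuousOn.intervalIntegrable <| hf.comp (by fun_prop) fun _ hx => horizontal_mem ha hab ht hx

theorem vertical_integrable (hf : ContinuousOn f puncturedHalfPlane) {s : ℝ} (hs : 0 < s)
    (hs1 : s ≠ 1) (c d : ℝ) :
    IntervalIntegrable (fun y : ℝ => f (s + y * Complex.I)) MeasureTheory.volume c d :=
  ContinuousOn.intervalIntegrable <| hf.comp (by fun_prop) fun _ _ => vertical_mem hs hs1 _

theorem rectIntegral_add (ha : 0 < a) (ha1 : a < 1) (hb : 1 < b) (hT : 0 < T)
    (hf : ContinuousOn f puncturedHalfPlane) (hg : ContinuousOn g puncturedHalfPlane) :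
    rectIntegral (fun v => f v + g v) a b T = rectIntegral f a b T + rectIntegral g a b T := by
  have hab : a ≤ b := by linarith
  have hT' : -T ≠ 0 := by linarith
  unfold rectIntegral
  rw [intervalIntegral.integral_add (horizontal_integrable hf ha hab hT')
      (horizontal_integrable hg ha hab hT'),
    intervalIntegral.integral_add (horizontal_integrable hf ha hab hT.ne')
      (horizontal_integrable hg ha hab hT.ne'),
    intervalIntegral.integral_add (vertical_integrable hf (by linarith) hb.ne' _ _)
      (vertical_integrable hg (by linarith) hb.ne' _ _),
    intervalIntegral.integral_add (vertical_integrable hf ha ha1.ne _ _)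
      (vertical_integrable hg ha ha1.ne _ _)]
  ring

theorem rectIntegral_const_mul (c : ℂ) :
    rectIntegral (fun v => c * f v) a b T = c * rectIntegral f a b T := by
  simp only [rectIntegral, intervalIntegral.integral_const_mul]
  ring

theorem rectIntegral_congr (ha : 0 < a) (ha1 : a < 1) (hb : 1 < b) (hT : 0 < T)
    (h : ∀ v ∈ puncturedHalfPlane, f v = g v) : rectIntegral f a b T = rectIntegral g a b T := by
  have hab : a ≤ b := by linarith
  have hT' : -T ≠ 0 := by linarith
  unfold rectIntegral
  rw [intervalIntegral.integral_congr fun x hx => h _ (horizontal_mem ha hab hT' hx),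
    intervalIntegral.integral_congr fun x hx => h _ (horizontal_mem ha hab hT.ne' hx),
    intervalIntegral.integral_congr fun y _ => h _ (vertical_mem (s := b) (by linarith) hb.ne' y),
    intervalIntegral.integral_congr fun y _ => h _ (vertical_mem (s := a) ha ha1.ne y)]

theorem rectIntegral_eq_zero_of_differentiableOn (ha : 0 < a) (hab : a ≤ b)
    (hf : DifferentiableOn ℂ f {v | 0 < v.re}) : rectIntegral f a b T = 0 := by
  refine Complex.integral_boundary_rect_eq_zero_of_differentiableOn f ⟨a, -T⟩ ⟨b, T⟩
    (hf.mono fun v hv => ?_)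
  have := hv.1
  simp only [mem_preimage, uIcc_of_le hab] at this
  exact ha.trans_le this.1

theorem integral_horizontal_of_hasDerivAt {t : ℝ}
    (hF : ∀ x ∈ uIcc a b, HasDerivAt F (f (x + t * Complex.I)) (x + t * Complex.I))
    (hi : IntervalIntegrable (fun x : ℝ => f (x + t * Complex.I)) MeasureTheory.volume a b) :
    ∫ x : ℝ in a..b, f (x + t * Complex.I) = F (b + t * Complex.I) - F (a + t * Complex.I) := by
  refine intervalIntegral.integral_eq_sub_of_hasDerivAt
    (f := fun x : ℝ => F (x + t * Complex.I)) (fun x hx => ?_) hi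
  have h := (hF x hx).comp x ((Complex.ofRealCLM.hasDerivAt (x := x)).add_const (t * Complex.I))
  simpa [Function.comp_def] using h

theorem integral_vertical_of_hasDerivAt {s c d : ℝ}
    (hF : ∀ y ∈ uIcc c d, HasDerivAt F (f (s + y * Complex.I)) (s + y * Complex.I))
    (hi : IntervalIntegrable (fun y : ℝ => f (s + y * Complex.I)) MeasureTheory.volume c d) :
    Complex.I * ∫ y : ℝ in c..d, f (s + y * Complex.I) =
      F (s + d * Complex.I) - F (s + c * Complex.I) := by
  rw [← intervalIntegral.integral_const_mul]
  refine intervalIntegral.integral_eq_sub_of_hasDerivAt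
    (f := fun y : ℝ => F (s + y * Complex.I)) (fun y hy => ?_) (hi.const_mul _)
  have h := (hF y hy).comp y
    (((Complex.ofRealCLM.hasDerivAt (x := y)).mul_const Complex.I).const_add (s : ℂ))
  simpa [Function.comp_def, mul_comm] using h

theorem rectIntegral_eq_zero_of_hasDerivAt (ha : 0 < a) (ha1 : a < 1) (hb : 1 < b) (hT : 0 < T)
    (hf : ContinuousOn f puncturedHalfPlane)
    (hF : ∀ v ∈ puncturedHalfPlane, HasDerivAt F (f v) v) : rectIntegral f a b T = 0 := by
  have hab : a ≤ b := by linarith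
  have hT' : -T ≠ 0 := by linarith
  unfold rectIntegral
  rw [integral_horizontal_of_hasDerivAt (fun x hx => hF _ (horizontal_mem ha hab hT' hx))
      (horizontal_integrable hf ha hab hT'),
    integral_horizontal_of_hasDerivAt (fun x hx => hF _ (horizontal_mem ha hab hT.ne' hx))
      (horizontal_integrable hf ha hab hT.ne'),
    integral_vertical_of_hasDerivAt
      (fun y _ => hF _ (vertical_mem (s := b) (by linarith) hb.ne' y))
      (vertical_integrable hf (by linarith) hb.ne' _ _),
    integral_vertical_of_hasDerivAt (fun y _ => hF _ (vertical_mem ha ha1.ne y))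
      (vertical_integrable hf ha ha1.ne _ _)]
  ring

theorem log_I_mul {z : ℂ} (hre : 0 < z.re) :
    Complex.log (Complex.I * z) = Complex.log z + π / 2 * Complex.I := by
  have hz : z ≠ 0 := fun h => by simp [h] at hre
  have h := Complex.abs_arg_lt_pi_div_two_iff.2 (Or.inl hre)
  rw [abs_lt] at h
  rw [(Complex.log_mul_eq_add_log_iff Complex.I_ne_zero hz).2, Complex.log_I, add_comm]
  rw [Complex.arg_I]
  constructor <;> linarith [Real.pi_pos]

/-- Each side is rotated by a power of `I` into the right half-plane around `v = 1`, where the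
principal logarithm is a primitive. The four primitives differ by `πi/2` at each corner, and the
jumps add up to `2πi`. -/
theorem rectIntegral_inv_sub_one (ha : 0 < a) (ha1 : a < 1) (hb : 1 < b) (hT : 0 < T) :
    rectIntegral (fun v => (v - 1)⁻¹) a b T = 2 * π * Complex.I := by
  have hab : a ≤ b := by linarith
  have hT' : -T ≠ 0 := by linarith
  have hc : ContinuousOn (fun v : ℂ => (v - 1)⁻¹) puncturedHalfPlane :=
    ContinuousOn.inv₀ (by fun_prop) fun v hv => sub_ne_zero.2 hv.2
  obtain ⟨f, hf⟩ : ∃ f : ℂ → ℂ, f = fun v => (v - 1)⁻¹ := ⟨_, rfl⟩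
  rw [← hf] at hc ⊢
  have key : ∀ c : ℂ, c ≠ 0 → ∀ v : ℂ, 0 < (c * (v - 1)).re →
      HasDerivAt (fun v => Complex.log (c * (v - 1))) (f v) v := by
    intro c hc v hv
    rw [hf]
    have h1 : HasDerivAt (fun v : ℂ => c * (v - 1)) (c * 1) v :=
      ((hasDerivAt_id v).sub_const 1).const_mul c
    have h := h1.clog (Or.inl hv)
    have hne : v - 1 ≠ 0 := fun e => by simp [e] at hv
    convert h using 1
    field_simp
  unfold rectIntegral
  rw [integral_horizontal_of_hasDerivAt (F := fun v => Complex.log (Complex.I * (v - 1)))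
      (fun x _ => key _ Complex.I_ne_zero _ (by simp [hT]))
      (horizontal_integrable hc ha hab hT'),
    integral_horizontal_of_hasDerivAt (F := fun v => Complex.log (-Complex.I * (v - 1)))
      (fun x _ => key _ (neg_ne_zero.2 Complex.I_ne_zero) _ (by simp [hT]))
      (horizontal_integrable hc ha hab hT.ne'),
    integral_vertical_of_hasDerivAt (F := fun v => Complex.log (1 * (v - 1)))
      (fun y _ => key _ one_ne_zero _ (by simp [hb]))
      (vertical_integrable hc (by linarith) hb.ne' _ _),
    integral_vertical_of_hasDerivAt (F := fun v => Complex.log (-1 * (v - 1)))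
      (fun y _ => key _ (by simp) _ (by simp [ha1]))
      (vertical_integrable hc ha ha1.ne _ _)]
  have e1 := log_I_mul (z := b + (-T : ℝ) * Complex.I - 1) (by simp [hb])
  have e2 := log_I_mul (z := -Complex.I * (b + T * Complex.I - 1)) (by simp [hT])
  have e3 := log_I_mul (z := -1 * (a + T * Complex.I - 1)) (by simp [ha1])
  have e4 := log_I_mul (z := Complex.I * (a + (-T : ℝ) * Complex.I - 1)) (by simp [hT])
  have i2 : Complex.I * (-Complex.I * (b + T * Complex.I - 1)) = 1 * (b + T * Complex.I - 1) := by
    linear_combination (-(b + T * Complex.I - 1) : ℂ) * Complex.I_mul_I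
  have i3 : Complex.I * (-1 * (a + T * Complex.I - 1)) = -Complex.I * (a + T * Complex.I - 1) := by
    ring
  have i4 : Complex.I * (Complex.I * (a + (-T : ℝ) * Complex.I - 1)) =
      -1 * (a + (-T : ℝ) * Complex.I - 1) := by
    linear_combination ((a + (-T : ℝ) * Complex.I - 1) : ℂ) * Complex.I_mul_I
  rw [i2] at e2
  rw [i3] at e3
  rw [i4] at e4
  rw [e1, e2, e3, e4, one_mul]
  ring

theorem norm_rectIntegral_le {M : ℝ} (hab : a ≤ b) (hT : 0 ≤ T)
    (hh : ∀ x ∈ Icc a b, ∀ t : ℝ, |t| = T → ‖f (x + t * Complex.I)‖ ≤ M)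
    (hv : ∀ s : ℝ, s = a ∨ s = b → ∀ y ∈ Icc (-T) T, ‖f (s + y * Complex.I)‖ ≤ M) :
    ‖rectIntegral f a b T‖ ≤ M * (2 * (b - a) + 4 * T) := by
  have h1 : ∀ t : ℝ, |t| = T → ‖∫ x : ℝ in a..b, f (x + t * Complex.I)‖ ≤ M * (b - a) := by
    intro t ht
    have := intervalIntegral.norm_integral_le_of_norm_le_const (a := a) (b := b) (C := M)
      (f := fun x : ℝ => f (x + t * Complex.I)) fun x hx => by
        rw [uIoc_of_le hab] at hx
        exact hh x ⟨hx.1.le, hx.2⟩ t ht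
    rwa [abs_of_nonneg (by linarith)] at this
  have h2 : ∀ s : ℝ, s = a ∨ s = b →
      ‖Complex.I * ∫ y : ℝ in (-T)..T, f (s + y * Complex.I)‖ ≤ M * (2 * T) := by
    intro s hs
    have := intervalIntegral.norm_integral_le_of_norm_le_const (a := -T) (b := T) (C := M)
      (f := fun y : ℝ => f (s + y * Complex.I)) fun y hy => by
        rw [uIoc_of_le (by linarith)] at hy
        exact hv s hs y ⟨hy.1.le, hy.2⟩
    rw [abs_of_nonneg (by linarith)] at this
    rw [norm_mul, Complex.norm_I, one_mul]
    linarith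
  have n1 := h1 (-T) (by rw [abs_neg, abs_of_nonneg hT])
  have n2 := h1 T (abs_of_nonneg hT)
  have n3 := h2 b (Or.inr rfl)
  have n4 := h2 a (Or.inl rfl)
  unfold rectIntegral
  refine (norm_sub_le _ _).trans ?_
  have s1 := norm_add_le ((∫ x : ℝ in a..b, f (x + (-T : ℝ) * Complex.I)) -
    (∫ x : ℝ in a..b, f (x + T * Complex.I)))
    (Complex.I * ∫ y : ℝ in (-T)..T, f (b + y * Complex.I))
  have s2 := norm_sub_le (∫ x : ℝ in a..b, f (x + (-T : ℝ) * Complex.I))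
    (∫ x : ℝ in a..b, f (x + T * Complex.I))
  linarith

/-- Cauchy's formula for higher derivatives after the substitution `w = p v`. -/
theorem rectIntegral_comp_eq_iterate_dslope (ha : 0 < a) (ha1 : a < 1) (hb : 1 < b) (hT : 0 < T)
    {U : Set ℂ} (hU : IsOpen U) {p p' : ℂ → ℂ} {w : ℂ} (hw : w ∈ U)
    (hp : ∀ v : ℂ, 0 < v.re → HasDerivAt p (p' v) v)
    (hp' : DifferentiableOn ℂ p' {v | 0 < v.re})
    (hpU : ∀ v : ℂ, 0 < v.re → p v ∈ U) (hp1 : p 1 = w) (hp1' : p' 1 ≠ 0)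
    (hinj : ∀ v ∈ puncturedHalfPlane, p v ≠ w) (n : ℕ) :
    ∀ Φ : ℂ → ℂ, DifferentiableOn ℂ Φ U →
      rectIntegral (fun v => Φ (p v) * p' v / (p v - w) ^ (n + 1)) a b T =
        2 * π * Complex.I * ((Function.swap dslope w)^[n] Φ) w := by
  have hab : a ≤ b := by linarith
  have hopen : IsOpen {v : ℂ | 0 < v.re} := isOpen_lt continuous_const Complex.continuous_re
  have hsub : puncturedHalfPlane ⊆ {v : ℂ | 0 < v.re} := fun v hv => hv.1
  have hpd : DifferentiableOn ℂ p {v | 0 < v.re} := fun v hv =>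
    (hp v hv).differentiableAt.differentiableWithinAt
  have hpc := hpd.continuousOn.mono hsub
  have hpc' := hp'.continuousOn.mono hsub
  have hcont : ∀ Φ : ℂ → ℂ, DifferentiableOn ℂ Φ U → ∀ k : ℕ,
      ContinuousOn (fun v => Φ (p v) * p' v / (p v - w) ^ k) puncturedHalfPlane := by
    intro Φ hΦ k
    refine ContinuousOn.div ((hΦ.continuousOn.comp hpc fun v hv => hpU v hv.1).mul hpc')
      ((hpc.sub continuousOn_const).pow k) fun v hv => pow_ne_zero _ (sub_ne_zero.2 (hinj v hv))
  have hmem : ({v : ℂ | 0 < v.re} : Set ℂ) ∈ 𝓝 (1 : ℂ) := hopen.mem_nhds (by simp)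
  have hdecomp : ∀ Φ : ℂ → ℂ, ∀ z, Φ z = Φ w + (z - w) * dslope Φ w z := by
    intro Φ z
    have := sub_smul_dslope Φ w z
    rw [smul_eq_mul] at this
    rw [this]; ring
  have hstep : ∀ Φ : ℂ → ℂ, DifferentiableOn ℂ Φ U → DifferentiableOn ℂ (dslope Φ w) U :=
    fun Φ hΦ => (Complex.differentiableOn_dslope (hU.mem_nhds hw)).2 hΦ
  -- `p v - w = (v - 1) q v` with `q = dslope p 1` zero-free, so the logarithmic derivative is `1/(v
  -- - 1)` plus a holomorphic function; the image contour never has to be examined.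
  have hlog : rectIntegral (fun v => p' v / (p v - w)) a b T = 2 * π * Complex.I := by
    have hqd : DifferentiableOn ℂ (dslope p 1) {v | 0 < v.re} :=
      (Complex.differentiableOn_dslope hmem).2 hpd
    have hq0 : ∀ v : ℂ, 0 < v.re → dslope p 1 v ≠ 0 := by
      intro v hv h0
      rcases eq_or_ne v 1 with rfl | hne
      · rw [dslope_same, (hp 1 hv).deriv] at h0
        exact hp1' h0
      · have := sub_smul_dslope p 1 v
        rw [h0, smul_zero, hp1] at this
        exact hinj v ⟨hv, hne⟩ (sub_eq_zero.1 this.symm)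
    have hq'd : DifferentiableOn ℂ (deriv (dslope p 1)) {v | 0 < v.re} := hqd.deriv hopen
    have hqd' : DifferentiableOn ℂ (fun v => deriv (dslope p 1) v / dslope p 1 v)
        {v | 0 < v.re} := hq'd.div hqd hq0
    rw [rectIntegral_congr (g := fun v => (v - 1)⁻¹ + deriv (dslope p 1) v / dslope p 1 v)
      ha ha1 hb hT, rectIntegral_add ha ha1 hb hT, rectIntegral_inv_sub_one ha ha1 hb hT,
      rectIntegral_eq_zero_of_differentiableOn ha hab hqd', add_zero]
    · exact ContinuousOn.inv₀ (by fun_prop) fun v hv => sub_ne_zero.2 hv.2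
    · exact hqd'.continuousOn.mono hsub
    · intro v hv
      have hq : HasDerivAt (dslope p 1) (deriv (dslope p 1) v) v :=
        (hqd.differentiableAt (hopen.mem_nhds hv.1)).hasDerivAt
      have hprod := (((hasDerivAt_id v).sub_const 1).mul hq).add_const w
      have heq : (fun z => (id z - 1) * dslope p 1 z + w) = p := by
        funext z
        have := sub_smul_dslope p 1 z
        rw [smul_eq_mul, hp1] at this
        simp only [id, this, sub_add_cancel]
      have hd : p' v = dslope p 1 v + (v - 1) * deriv (dslope p 1) v := by
        have h2 := hprod
        change HasDerivAt (fun z => (id z - 1) * dslope p 1 z + w) _ v at h2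
        rw [heq] at h2
        simpa using (hp v hv.1).unique h2
      have hv' : p v - w = (v - 1) * dslope p 1 v := by
        have := sub_smul_dslope p 1 v
        rw [smul_eq_mul, hp1] at this
        exact this.symm
      have h1 : v - 1 ≠ 0 := sub_ne_zero.2 hv.2
      have h2 := hq0 v hv.1
      rw [hd, hv']
      field_simp
  -- Split `Φ z = Φ w + (z - w) * dslope Φ w z`. For exponent at least two the constant part has a
  -- primitive and integrates to zero; the other part lowers the exponent by one.
  induction n with
  | zero =>
    intro Φ hΦ
    have hΨ : DifferentiableOn ℂ (fun v => dslope Φ w (p v) * p' v) {v | 0 < v.re} :=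
      ((hstep Φ hΦ).comp hpd fun v hv => hpU v hv).mul hp'
    have hc1 : ContinuousOn (fun v => Φ w * (p' v / (p v - w))) puncturedHalfPlane :=
      continuousOn_const.mul (hpc'.div (hpc.sub continuousOn_const)
        fun v hv => sub_ne_zero.2 (hinj v hv))
    rw [rectIntegral_congr (g := fun v => Φ w * (p' v / (p v - w)) + dslope Φ w (p v) * p' v)
      ha ha1 hb hT, rectIntegral_add ha ha1 hb hT hc1 (hΨ.continuousOn.mono hsub),
      rectIntegral_const_mul, hlog, rectIntegral_eq_zero_of_differentiableOn ha hab hΨ]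
    · simp [mul_comm]
    · intro v hv
      have h1 : p v - w ≠ 0 := sub_ne_zero.2 (hinj v hv)
      rw [hdecomp Φ (p v)]
      field_simp
      ring
  | succ n ih =>
    intro Φ hΦ
    have hc1 : ContinuousOn (fun v => Φ w * (p' v / (p v - w) ^ (n + 2))) puncturedHalfPlane :=
      continuousOn_const.mul (hpc'.div ((hpc.sub continuousOn_const).pow _)
        fun v hv => pow_ne_zero _ (sub_ne_zero.2 (hinj v hv)))
    rw [Function.iterate_succ_apply]
    change _ = 2 * π * Complex.I * (Function.swap dslope w)^[n] (dslope Φ w) w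
    rw [← ih _ (hstep Φ hΦ), rectIntegral_congr (g := fun v =>
      Φ w * (p' v / (p v - w) ^ (n + 2)) + dslope Φ w (p v) * p' v / (p v - w) ^ (n + 1))
      ha ha1 hb hT, rectIntegral_add ha ha1 hb hT hc1 (hcont _ (hstep Φ hΦ) _),
      rectIntegral_eq_zero_of_hasDerivAt
        (F := fun v => Φ w * (-(1 / ((n : ℂ) + 1)) * ((p v - w) ^ (n + 1))⁻¹)) ha ha1 hb hT hc1,
      zero_add]
    · intro v hv
      have h1 : p v - w ≠ 0 := sub_ne_zero.2 (hinj v hv)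
      have hn : (n : ℂ) + 1 ≠ 0 := by exact_mod_cast n.succ_ne_zero
      have hd := ((((hp v hv.1).sub_const w).pow (n + 1)).inv (pow_ne_zero _ h1)).const_mul
        (-(1 / ((n : ℂ) + 1)))
      refine (hd.const_mul (Φ w)).congr_deriv ?_
      simp only [Pi.pow_apply, Nat.add_sub_cancel, Nat.cast_add, Nat.cast_one]
      field_simp
      ring
    · intro v hv
      have h1 : p v - w ≠ 0 := sub_ne_zero.2 (hinj v hv)
      rw [hdecomp Φ (p v)]
      field_simp
      ring

/-- Each `dslope` shifts the Taylor series at `w` by one place. -/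
theorem iterate_dslope_eq_iteratedDeriv {Φ : ℂ → ℂ} {w : ℂ} (h : AnalyticAt ℂ Φ w) (n : ℕ) :
    ((Function.swap dslope w)^[n] Φ) w = iteratedDeriv n Φ w / n.factorial := by
  have hp := h.hasFPowerSeriesAt
  have h1 := (HasFPowerSeriesAt.has_fpower_series_iterate_dslope_fslope n hp).coeff_zero 1
  rw [← h1]
  change (FormalMultilinearSeries.fslope^[n] _).coeff 0 = _
  rw [FormalMultilinearSeries.coeff_iterate_fslope, zero_add]
  simp [FormalMultilinearSeries.coeff_ofScalars]

end Rect

/-! ### The integral representation of `W_n` and the resulting bound. -/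

theorem iteratedDeriv_eq_ofReal {Φ : ℂ → ℂ} {φ : ℝ → ℝ} (hΦ : DifferentiableOn ℂ Φ {v | 0 < v.re})
    (h : ∀ t : ℝ, 0 < t → Φ t = φ t) (k : ℕ) :
    ∀ t : ℝ, 0 < t → iteratedDeriv k Φ t = (iteratedDeriv k φ t : ℝ) := by
  have hopen : IsOpen {v : ℂ | 0 < v.re} := isOpen_lt continuous_const Complex.continuous_re
  induction k with
  | zero => simpa using h
  | succ k ih =>
    intro t ht
    have hd : DifferentiableAt ℂ (iteratedDeriv k Φ) t := by
      rw [iteratedDeriv_eq_iterate]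
      exact ((hΦ.analyticOnNhd hopen).iterated_deriv k (t : ℂ)
        (by simpa using ht)).differentiableAt
    have h1 := hd.hasDerivAt.comp_ofReal
    have hev : (fun y : ℝ => iteratedDeriv k Φ y) =ᶠ[𝓝 t]
        fun y : ℝ => ((iteratedDeriv k φ y : ℝ) : ℂ) := by
      filter_upwards [lt_mem_nhds ht] with y hy using ih y hy
    have h2 := h1.congr_of_eventuallyEq hev.symm
    have h3 : HasDerivAt (iteratedDeriv k φ) (deriv (iteratedDeriv k Φ) t).re t := by
      have := Complex.reCLM.hasFDerivAt.comp_hasDerivAt t h2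
      simpa [Function.comp_def] using this
    rw [iteratedDeriv_succ, iteratedDeriv_succ, h3.deriv]
    exact h2.unique h3.ofReal_comp

theorem cpow_re_pos {α : ℝ} (hα : 0 < α) (hα1 : α ≤ 1) {v : ℂ} (hv : 0 < v.re) :
    0 < (v ^ (α : ℂ)).re := by
  have hv0 : v ≠ 0 := fun h => by simp [h] at hv
  rw [Complex.cpow_ofReal_re]
  have h := abs_lt.1 (Complex.abs_arg_lt_pi_div_two_iff.2 (Or.inl hv))
  have hp := Real.pi_pos
  refine mul_pos (rpow_pos_of_pos (norm_pos_iff.2 hv0) _) (cos_pos_of_mem_Ioo ⟨?_, ?_⟩) <;>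
    nlinarith [h.1, h.2]

/-- For `α ≤ 1` the argument stays inside the principal branch. This makes `v ↦ v^α` injective on
the half-plane and turns the weight's exponent into `-x^{1/α} v`. -/
theorem cpow_cpow_inv {α : ℝ} (hα : 0 < α) (hα1 : α ≤ 1) {v : ℂ} (hv : 0 < v.re) :
    (v ^ (α : ℂ)) ^ ((1 / α : ℝ) : ℂ) = v := by
  have hv0 : v ≠ 0 := fun h => by simp [h] at hv
  have h := abs_lt.1 (Complex.abs_arg_lt_pi_div_two_iff.2 (Or.inl hv))
  have hp := Real.pi_pos
  have him : (Complex.log v * α).im = v.arg * α := by simp [Complex.log_im]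
  rw [← Complex.cpow_mul, ← Complex.ofReal_mul, mul_one_div_cancel hα.ne', Complex.ofReal_one,
    Complex.cpow_one]
  · rw [him]; nlinarith [h.1, h.2]
  · rw [him]; nlinarith [h.1, h.2]

theorem ofReal_mul_cpow {x : ℝ} (hx : 0 < x) {z : ℂ} (hz : z ≠ 0) (s : ℝ) :
    ((x : ℂ) * z) ^ (s : ℂ) = (x ^ s : ℝ) * z ^ (s : ℂ) := by
  have hx' : (x : ℂ) ≠ 0 := by exact_mod_cast hx.ne'
  rw [Complex.cpow_def_of_ne_zero (mul_ne_zero hx' hz), Complex.log_ofReal_mul hx hz, add_mul,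
    Complex.exp_add, Complex.ofReal_cpow hx.le, Complex.cpow_def_of_ne_zero hx',
    Complex.cpow_def_of_ne_zero hz, Complex.ofReal_log hx.le]

theorem gamma_arg_pos {α β : ℝ} (hα : 0 < α) (hβ : 1 - 1 / α ≤ β) : 0 < α * β + 1 := by
  have : α * (1 - 1 / α) ≤ α * β := mul_le_mul_of_nonneg_left hβ hα.le
  rw [mul_sub, mul_one_div_cancel hα.ne'] at this
  linarith

/-- The distance of `v ^ (-α)` to `1`. -/
def gap (α : ℝ) (v : ℂ) : ℝ := ‖1 - v ^ ((-α : ℝ) : ℂ)‖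

theorem norm_cpow_sub_one {α : ℝ} {v : ℂ} (hv : v ≠ 0) :
    ‖v ^ (α : ℂ) - 1‖ = ‖v‖ ^ α * gap α v := by
  have h : v ^ (α : ℂ) - 1 = v ^ (α : ℂ) * (1 - v ^ ((-α : ℝ) : ℂ)) := by
    rw [mul_sub, mul_one, ← Complex.cpow_add _ _ hv]
    simp
  rw [h, norm_mul, Complex.norm_cpow_real, gap]

/-- Cauchy's formula with `p v = x v^α`. The powers of `x` and `|v|^α` from `w^n`, from `p'` and
from the denominator cancel, leaving `|v|^{αβ-α}` and a bare power of the gap. -/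
theorem abs_W_le_of_rect {α β : ℝ} (hα : 0 < α) (hα1 : α ≤ 1) (hβ : 1 - 1 / α ≤ β) {n : ℕ}
    {x : ℝ} (hx : 0 < x) {a b T M : ℝ} (ha : 0 < a) (ha1 : a < 1) (hb : 1 < b) (hT : 0 < T)
    (hM : ∀ v : ℂ, a ≤ v.re → v.re ≤ b → |v.im| ≤ T → (v.re = a ∨ v.re = b ∨ |v.im| = T) →
      ‖v‖ ^ (α * β - α) * exp (-(x ^ (1 / α) * v.re)) / gap α v ^ (n + 1) ≤ M) :
    |W α β n x| ≤
      x ^ betaIdx α β * (α / Gamma (α * β + 1)) * M * (2 * (b - a) + 4 * T) / (2 * π) := by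
  have hopen : IsOpen {v : ℂ | 0 < v.re} := isOpen_lt continuous_const Complex.continuous_re
  have hG : 0 < Gamma (α * β + 1) := Gamma_pos_of_pos (gamma_arg_pos hα hβ)
  have hx' : (x : ℂ) ≠ 0 := by exact_mod_cast hx.ne'
  have hα' : (α : ℂ) ≠ 0 := by exact_mod_cast hα.ne'
  have hne : ∀ v : ℂ, 0 < v.re → v ≠ 0 := fun v hv h => by simp [h] at hv
  set Φ : ℂ → ℂ := fun w => w ^ n * (w ^ ((betaIdx α β : ℝ) : ℂ) *
    Complex.exp (-w ^ ((1 / α : ℝ) : ℂ)) / (Gamma (α * β + 1) : ℝ)) with hΦdef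
  have hcp : ∀ s : ℂ, DifferentiableOn ℂ (fun w : ℂ => w ^ s) {v | 0 < v.re} := fun s v hv =>
    (((hasDerivAt_id v).cpow_const (Or.inl hv)).differentiableAt).differentiableWithinAt
  have hΦ : DifferentiableOn ℂ Φ {v | 0 < v.re} :=
    (differentiableOn_id.pow n).mul (((hcp _).mul (hcp _).neg.cexp).div_const _)
  have hreal : ∀ t : ℝ, 0 < t → Φ t = ((t ^ n * weight α β t : ℝ) : ℂ) := by
    intro t ht
    simp only [hΦdef, weight, betaIdx]
    push_cast [Complex.ofReal_cpow ht.le]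
    rfl
  set p : ℂ → ℂ := fun v => x * v ^ (α : ℂ) with hp
  set p' : ℂ → ℂ := fun v => x * (α * v ^ ((α : ℂ) - 1)) with hp'
  have hpd : ∀ v : ℂ, 0 < v.re → HasDerivAt p (p' v) v := by
    intro v hv
    have := ((hasDerivAt_id v).cpow_const (c := (α : ℂ)) (Or.inl hv)).const_mul (x : ℂ)
    simpa using this
  have hp'd : DifferentiableOn ℂ p' {v | 0 < v.re} := ((hcp _).const_mul _).const_mul _
  have hp1 : p 1 = x := by simp [hp]
  have hinj : ∀ v ∈ puncturedHalfPlane, p v ≠ x := by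
    intro v hv h
    have h1 : v ^ (α : ℂ) = 1 := mul_left_cancel₀ hx' (by rw [mul_one]; exact h)
    have h2 := cpow_cpow_inv hα hα1 hv.1
    rw [h1, Complex.one_cpow] at h2
    exact hv.2 h2.symm
  have hpU : ∀ v : ℂ, 0 < v.re → p v ∈ {v : ℂ | 0 < v.re} := by
    intro v hv
    simpa [hp] using mul_pos hx (cpow_re_pos hα hα1 hv)
  have hcauchy := rectIntegral_comp_eq_iterate_dslope ha ha1 hb hT hopen (w := (x : ℂ))
    (by simpa using hx) hpd hp'd hpU hp1
    (by simp [hp', hx', hα']) hinj n Φ hΦ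
  rw [iterate_dslope_eq_iteratedDeriv (hΦ.analyticOnNhd hopen (x : ℂ) (by simpa using hx)),
    iteratedDeriv_eq_ofReal hΦ hreal n x hx] at hcauchy
  have hw : 0 < weight α β x := by unfold weight; positivity
  have hW : |W α β n x| =
      |iteratedDeriv n (fun y => y ^ n * weight α β y) x| / n.factorial := by
    have hf : (0 : ℝ) < n.factorial := by exact_mod_cast n.factorial_pos
    rw [W, coEigen, abs_mul, abs_mul, abs_div, abs_mul, abs_pow, abs_neg, abs_one, one_pow,
      abs_of_pos hw, abs_of_pos hf]
    field_simp
  have hnorm := congrArg norm hcauchy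
  rw [norm_mul, norm_div, Complex.norm_real, Complex.norm_natCast, Real.norm_eq_abs, ← hW] at hnorm
  have h2pi : ‖(2 * π * Complex.I : ℂ)‖ = 2 * π := by
    simp [abs_of_pos Real.pi_pos]
  rw [h2pi] at hnorm
  have hint : ∀ v : ℂ, a ≤ v.re → v.re ≤ b → |v.im| ≤ T →
      (v.re = a ∨ v.re = b ∨ |v.im| = T) →
      ‖Φ (p v) * p' v / (p v - x) ^ (n + 1)‖ ≤
        x ^ betaIdx α β * (α / Gamma (α * β + 1)) * M := by
    intro v h1 h2 h3 h4
    have hv : 0 < v.re := ha.trans_le h1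
    have hv0 := hne v hv
    have hN : 0 < ‖v‖ := norm_pos_iff.2 hv0
    have hcv : v ^ (α : ℂ) ≠ 0 := by simp [Complex.cpow_eq_zero_iff, hv0]
    have e1 : ‖p v‖ = x * ‖v‖ ^ α := by
      simp [hp, abs_of_pos hx, Complex.norm_cpow_real]
    have e2 : ‖p' v‖ = x * (α * ‖v‖ ^ (α - 1)) := by
      have : ((α : ℂ) - 1) = ((α - 1 : ℝ) : ℂ) := by push_cast; rfl
      simp only [hp', this, norm_mul, Complex.norm_cpow_real, Complex.norm_real, Real.norm_eq_abs,
        abs_of_pos hx, abs_of_pos hα]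
    have e3 : ‖p v - x‖ = x * (‖v‖ ^ α * gap α v) := by
      rw [← norm_cpow_sub_one hv0, show p v - x = x * (v ^ (α : ℂ) - 1) by simp only [hp]; ring,
        norm_mul, Complex.norm_real, Real.norm_eq_abs, abs_of_pos hx]
    have e4 : (p v) ^ ((1 / α : ℝ) : ℂ) = (x ^ (1 / α) : ℝ) * v := by
      rw [hp, ofReal_mul_cpow hx hcv, cpow_cpow_inv hα hα1 hv]
    have e5 : ‖Φ (p v)‖ = (x * ‖v‖ ^ α) ^ n * (x ^ betaIdx α β * ‖v‖ ^ (α * betaIdx α β) *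
        exp (-(x ^ (1 / α) * v.re)) / Gamma (α * β + 1)) := by
      simp only [hΦdef]
      rw [norm_mul, norm_div, norm_mul, norm_pow, Complex.norm_cpow_real, e1, e4,
        Complex.norm_exp, Complex.norm_real, Real.norm_eq_abs, abs_of_pos hG,
        mul_rpow hx.le (by positivity), ← rpow_mul hN.le]
      congr 5
      simp
    have e6 : ‖v‖ ^ (α * betaIdx α β) * ‖v‖ ^ (α - 1) = ‖v‖ ^ (α * β - α) * ‖v‖ ^ α := by
      rw [← rpow_add hN, ← rpow_add hN]
      congr 1
      unfold betaIdx
      field_simp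
      ring
    have hgap : 0 < gap α v ∨ gap α v = 0 := (norm_nonneg _).lt_or_eq.imp id Eq.symm
    have hfin : ‖Φ (p v) * p' v / (p v - x) ^ (n + 1)‖ =
        x ^ betaIdx α β * (α / Gamma (α * β + 1)) *
          (‖v‖ ^ (α * β - α) * exp (-(x ^ (1 / α) * v.re)) / gap α v ^ (n + 1)) := by
      have hNα : 0 < ‖v‖ ^ α := rpow_pos_of_pos hN _
      rw [norm_div, norm_mul, norm_pow, e2, e3, e5]
      rcases hgap with hg | hg
      · generalize exp (-(x ^ (1 / α) * v.re)) = ex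
        calc _ = (x * ‖v‖ ^ α) ^ n * x ^ betaIdx α β * ex / Gamma (α * β + 1) * x * α *
              (‖v‖ ^ (α * betaIdx α β) * ‖v‖ ^ (α - 1)) /
                (x * (‖v‖ ^ α * gap α v)) ^ (n + 1) := by ring
          _ = _ := by
            rw [e6]
            field_simp
            ring
      -- With a zero gap both quotients are `0` by the convention on division by zero.
      · simp [hg]
    rw [hfin]
    exact mul_le_mul_of_nonneg_left (hM v h1 h2 h3 h4) (by positivity)
  have hle := norm_rectIntegral_le (f := fun v => Φ (p v) * p' v / (p v - x) ^ (n + 1))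
    (M := x ^ betaIdx α β * (α / Gamma (α * β + 1)) * M) (a := a) (b := b) (T := T)
    (by linarith) hT.le
    (fun s hs t ht => hint _ (by simpa using hs.1) (by simpa using hs.2) (by simp [ht])
      (Or.inr (Or.inr (by simp [ht]))))
    (fun s hs y hy => hint _
      (by rcases hs with h | h <;> (simp [h]; try linarith))
      (by rcases hs with h | h <;> (simp [h]; try linarith)) (by simpa using abs_le.2 hy)
      (by rcases hs with h | h <;> simp [h]))
  rw [le_div_iff₀ (by positivity), mul_comm]
  exact hnorm.symm.le.trans hle

/-! ### Sine quotients, the function `κ̄_α` and the three constants. -/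

theorem mul_sin_le_sin_mul {s u : ℝ} (hs : 0 ≤ s) (hs1 : s ≤ 1) (hu : 0 ≤ u) (hu' : u ≤ π) :
    s * sin u ≤ sin (s * u) := by
  have := strictConcaveOn_sin_Icc.concaveOn.2 (x := 0) (y := u) ⟨le_rfl, Real.pi_pos.le⟩ ⟨hu, hu'⟩
    (sub_nonneg.2 hs1) hs (by ring)
  simpa using this

theorem mul_sin_lt_sin_mul {s u : ℝ} (hs : 0 < s) (hs1 : s < 1) (hu : 0 < u) (hu' : u ≤ π) :
    s * sin u < sin (s * u) := by
  have := strictConcaveOn_sin_Icc.2 (x := 0) (y := u) ⟨le_rfl, Real.pi_pos.le⟩ ⟨hu.le, hu'⟩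
    hu.ne (sub_pos.2 hs1) hs (by ring)
  simpa using this

/-- The numerator of the derivative is half of `(b-a) sin((b+a)θ) - (b+a) sin((b-a)θ)`. It is
negative by strict concavity of sine while `(b+a)θ ≤ π`; beyond that the first sine is nonpositive
and the second still positive. -/
theorem sin_ratio_strictAntiOn {a b : ℝ} (ha : 0 < a) (ha1 : a ≤ 1) (hab : a < b) (hb : b ≤ 2) :
    StrictAntiOn (fun θ => sin (b * θ) / sin (a * θ)) (Ioc 0 (π / 2)) := by
  have hpi := Real.pi_pos
  have hsin : ∀ θ ∈ Ioc 0 (π / 2), 0 < sin (a * θ) := fun θ hθ =>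
    sin_pos_of_pos_of_lt_pi (mul_pos ha hθ.1) (by nlinarith [hθ.1, hθ.2])
  refine strictAntiOn_of_deriv_neg (convex_Ioc _ _)
    (ContinuousOn.div (by fun_prop) (by fun_prop) fun θ hθ => (hsin θ hθ).ne') fun θ hθ => ?_
  rw [interior_Ioc] at hθ
  have h0 := hsin θ ⟨hθ.1, hθ.2.le⟩
  have hd1 : HasDerivAt (fun θ => sin (b * θ)) (cos (b * θ) * b) θ := by
    simpa using ((hasDerivAt_id θ).const_mul b).sin
  have hd2 : HasDerivAt (fun θ => sin (a * θ)) (cos (a * θ) * a) θ := by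
    simpa using ((hasDerivAt_id θ).const_mul a).sin
  have hd := hd1.div hd2 h0.ne'
  have hd' : deriv (fun θ => sin (b * θ) / sin (a * θ)) θ = _ := hd.deriv
  rw [hd']
  refine div_neg_of_neg_of_pos ?_ (by positivity)
  have e : cos (b * θ) * b * sin (a * θ) - sin (b * θ) * (cos (a * θ) * a) =
      ((b - a) * sin ((b + a) * θ) - (b + a) * sin ((b - a) * θ)) / 2 := by
    rw [show (b + a) * θ = b * θ + a * θ by ring, show (b - a) * θ = b * θ - a * θ by ring,
      sin_add, sin_sub]
    ring
  rw [e]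
  have hp : 0 < b + a := by linarith
  have hs : 0 < b - a := by linarith
  have key : (b - a) * sin ((b + a) * θ) < (b + a) * sin ((b - a) * θ) := by
    rcases le_or_gt ((b + a) * θ) π with h | h
    · have := mul_sin_lt_sin_mul (s := (b - a) / (b + a)) (u := (b + a) * θ) (by positivity)
        (by rw [div_lt_one hp]; linarith) (mul_pos hp hθ.1) h
      rw [show (b - a) / (b + a) * ((b + a) * θ) = (b - a) * θ by field_simp, div_mul_eq_mul_div,
        div_lt_iff₀ hp] at this
      linarith
    · have h1 : sin ((b + a) * θ) ≤ 0 := by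
        have h2 : 0 ≤ sin ((b + a) * θ - π) :=
          sin_nonneg_of_nonneg_of_le_pi (by linarith) (by nlinarith [hθ.1, hθ.2])
        rw [sin_sub_pi] at h2
        linarith
      have h2 : 0 < sin ((b - a) * θ) :=
        sin_pos_of_pos_of_lt_pi (mul_pos hs hθ.1) (by nlinarith [hθ.1, hθ.2])
      nlinarith
  linarith

theorem tendsto_sin_ratio {a b : ℝ} (hb : b ≠ 0) :
    Tendsto (fun θ => sin (a * θ) / sin (b * θ)) (𝓝[>] 0) (𝓝 (a / b)) := by
  have key : ∀ c : ℝ, Tendsto (fun θ => sin (c * θ) / θ) (𝓝[>] 0) (𝓝 c) := by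
    intro c
    have hd : HasDerivAt (fun θ => sin (c * θ)) c 0 := by
      simpa using ((hasDerivAt_id (0 : ℝ)).const_mul c).sin
    have := hd.tendsto_slope_zero_right
    simpa [div_eq_inv_mul] using this
  refine ((key a).div (key b) hb).congr' ?_
  filter_upwards [self_mem_nhdsWithin] with θ hθ
  have : θ ≠ 0 := (Set.mem_Ioi.1 hθ).ne'
  simp only [Pi.div_apply]
  field_simp

theorem sin_one_add_pos {α θ : ℝ} (hα : 0 < α) (hα1 : α ≤ 1) (h0 : 0 < θ) (h1 : θ < π / 2) :
    0 < sin ((1 + α) * θ) :=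
  sin_pos_of_pos_of_lt_pi (by positivity) (by nlinarith)

theorem sin_mul_pos {α θ : ℝ} (hα : 0 < α) (hα1 : α ≤ 1) (h0 : 0 < θ) (h1 : θ ≤ π / 2) :
    0 < sin (α * θ) :=
  sin_pos_of_pos_of_lt_pi (by positivity) (by nlinarith [Real.pi_pos])

/-- Both sine quotients decrease. At the larger angle only nonnegativity is used, because
`sin((1+α)θ)` vanishes for `α = 1`, `θ = π/2`. -/
theorem kappaBar_strictAntiOn {α : ℝ} (hα : 0 < α) (hα1 : α ≤ 1) :
    StrictAntiOn (kappaBar α) (Ioc 0 (π / 2)) := by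
  intro θ₁ h₁ θ₂ h₂ hlt
  have f := sin_ratio_strictAntiOn (a := 1) (b := 1 + α) one_pos le_rfl (by linarith)
    (by linarith) h₁ h₂ hlt
  have g := sin_ratio_strictAntiOn (a := α) (b := 1 + α) hα hα1 (by linarith)
    (by linarith) h₁ h₂ hlt
  simp only [one_mul] at f
  have hs : 0 ≤ sin ((1 + α) * θ₂) :=
    sin_nonneg_of_nonneg_of_le_pi (by nlinarith [h₂.1]) (by nlinarith [h₂.1, h₂.2])
  have f0 : 0 ≤ sin ((1 + α) * θ₂) / sin θ₂ :=
    div_nonneg hs (sin_pos_of_pos_of_lt_pi h₂.1 (by linarith [h₂.2, Real.pi_pos])).le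
  have g0 : 0 ≤ sin ((1 + α) * θ₂) / sin (α * θ₂) :=
    div_nonneg hs (sin_mul_pos hα hα1 h₂.1 h₂.2).le
  unfold kappaBar
  rw [mul_assoc, mul_assoc]
  exact mul_lt_mul_of_pos_left (mul_lt_mul'' f (rpow_lt_rpow g0 g hα) f0 (rpow_nonneg g0 _))
    (rpow_pos_of_pos hα _)

theorem kappaBar_tendsto {α : ℝ} (hα : 0 < α) :
    Tendsto (kappaBar α) (𝓝[>] 0) (𝓝 (Abar α)) := by
  have f := tendsto_sin_ratio (a := 1 + α) (b := 1) one_ne_zero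
  have g := (tendsto_sin_ratio (a := 1 + α) (b := α) hα.ne').rpow_const (p := α) (Or.inr hα.le)
  simp only [one_mul] at f
  have h := (f.const_mul (α ^ α)).mul g
  have e : α ^ α * ((1 + α) / 1) * ((1 + α) / α) ^ α = Abar α := by
    have : 0 < α ^ α := rpow_pos_of_pos hα _
    rw [div_rpow (by linarith) hα.le, Abar, rpow_add_one (by linarith)]
    field_simp
  rw [e] at h
  exact h

theorem kappaBar_half_pi {α : ℝ} (hα : 0 < α) (hα1 : α ≤ 1) : kappaBar α (π / 2) = Cbar α := by
  have e : sin ((1 + α) * (π / 2)) = cos (π / 2 * α) := by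
    rw [show (1 + α) * (π / 2) = π / 2 * α + π / 2 by ring, sin_add_pi_div_two]
  have hc : 0 ≤ cos (π / 2 * α) :=
    cos_nonneg_of_neg_pi_div_two_le_of_le (by nlinarith [Real.pi_pos]) (by nlinarith [Real.pi_pos])
  have hs := sin_mul_pos (θ := π / 2) hα hα1 (by linarith [Real.pi_pos]) le_rfl
  rw [kappaBar, Cbar, e, sin_pi_div_two, div_one, div_rpow hc hs.le, mul_comm α (π / 2),
    add_comm α 1, rpow_add' hc (by linarith), rpow_one]
  ring

theorem kappaBar_quarter {α : ℝ} (hα : 0 < α) (hα1 : α ≤ 1) :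
    kappaBar α (π / (2 * (1 + α))) = Bbar α := by
  have h1 : (1 + α) * (π / (2 * (1 + α))) = π / 2 := by field_simp
  have h2 : α * (π / (2 * (1 + α))) = π * α / (2 * (1 + α)) := by ring
  have hs : 0 < sin (π * α / (2 * (1 + α))) := by
    rw [← h2]
    refine sin_mul_pos hα hα1 (by positivity) ?_
    gcongr
    linarith
  rw [kappaBar, Bbar, h1, h2, sin_pi_div_two, one_div (sin (π * α / _)), inv_rpow hs.le]
  ring

theorem kappaBar_le_Abar {α θ : ℝ} (hα : 0 < α) (hα1 : α ≤ 1) (h0 : 0 < θ) (h1 : θ ≤ π / 2) :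
    kappaBar α θ ≤ Abar α := by
  refine ge_of_tendsto (kappaBar_tendsto hα) ?_
  filter_upwards [Ioo_mem_nhdsGT h0] with φ hφ
  exact (kappaBar_strictAntiOn hα hα1 ⟨hφ.1, hφ.2.le.trans h1⟩ ⟨h0, h1⟩ hφ.2).le

theorem Cbar_le_Bbar {α : ℝ} (hα : 0 < α) (hα1 : α ≤ 1) : Cbar α ≤ Bbar α := by
  have hp := Real.pi_pos
  have h : π / (2 * (1 + α)) ≤ π / 2 := by gcongr; linarith
  rw [← kappaBar_half_pi hα hα1, ← kappaBar_quarter hα hα1]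
  exact (kappaBar_strictAntiOn hα hα1).antitoneOn ⟨by positivity, h⟩ ⟨by positivity, le_rfl⟩ h

theorem Bbar_le_Abar {α : ℝ} (hα : 0 < α) (hα1 : α ≤ 1) : Bbar α ≤ Abar α := by
  rw [← kappaBar_quarter hα hα1]
  refine kappaBar_le_Abar hα hα1 (by positivity) ?_
  gcongr
  linarith

/-! ### The minimum of the gap on a vertical line. -/

/-- The value of `σ ^ (-α)` for which the line `Re v = σ` has its saddle point at angle `φ`. -/
def saddleRatio (α φ : ℝ) : ℝ := sin ((1 + α) * φ) / (sin φ * cos φ ^ α)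

/-- The logarithmic derivative has the sign of `(1+α) sin((1-α)φ) - (1-α) sin((1+α)φ)`, nonnegative
by concavity of sine. Monotonicity is not strict: the ratio is constantly `2` when `α = 1`. -/
theorem saddleRatio_monotoneOn {α : ℝ} (hα : 0 < α) (hα1 : α ≤ 1) :
    MonotoneOn (saddleRatio α) (Ioo 0 (π / 2)) := by
  have hp := Real.pi_pos
  have hs : ∀ φ ∈ Ioo 0 (π / 2), 0 < sin φ := fun φ h =>
    sin_pos_of_pos_of_lt_pi h.1 (by linarith [h.2])
  have hc : ∀ φ ∈ Ioo 0 (π / 2), 0 < cos φ := fun φ h =>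
    cos_pos_of_mem_Ioo ⟨by linarith [h.1], h.2⟩
  have ht : ∀ φ ∈ Ioo 0 (π / 2), 0 < sin ((1 + α) * φ) := fun φ h =>
    sin_one_add_pos hα hα1 h.1 h.2
  have hd : ∀ φ ∈ Ioo 0 (π / 2),
      HasDerivAt (fun φ => log (sin ((1 + α) * φ)) - log (sin φ) - α * log (cos φ))
        (cos ((1 + α) * φ) * (1 + α) / sin ((1 + α) * φ) - cos φ / sin φ -
          α * (-sin φ / cos φ)) φ := by
    intro φ h
    have h1 : HasDerivAt (fun φ => sin ((1 + α) * φ)) (cos ((1 + α) * φ) * (1 + α)) φ := by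
      simpa using ((hasDerivAt_id φ).const_mul (1 + α)).sin
    exact ((h1.log (ht φ h).ne').sub ((hasDerivAt_sin φ).log (hs φ h).ne')).sub
      (((hasDerivAt_cos φ).log (hc φ h).ne').const_mul α)
  have hmono : MonotoneOn (fun φ => log (sin ((1 + α) * φ)) - log (sin φ) - α * log (cos φ))
      (Ioo 0 (π / 2)) := by
    refine monotoneOn_of_deriv_nonneg (convex_Ioo _ _)
      (fun φ h => (hd φ h).continuousAt.continuousWithinAt) ?_ ?_ <;> rw [interior_Ioo]
    · exact fun φ h => (hd φ h).differentiableAt.differentiableWithinAt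
    · intro φ h
      rw [(hd φ h).deriv]
      have h1 := hs φ h
      have h2 := hc φ h
      have h3 := ht φ h
      have e : cos ((1 + α) * φ) * (1 + α) / sin ((1 + α) * φ) - cos φ / sin φ -
          α * (-sin φ / cos φ) = ((1 + α) * sin ((1 - α) * φ) - (1 - α) * sin ((1 + α) * φ)) /
            (2 * (sin ((1 + α) * φ) * sin φ * cos φ)) := by
        have e1 : sin ((1 - α) * φ) = 2 * sin φ * cos φ * cos ((1 + α) * φ) -
            (2 * cos φ ^ 2 - 1) * sin ((1 + α) * φ) := by
          rw [← sin_two_mul, ← cos_two_mul, ← sin_sub]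
          congr 1
          ring
        rw [e1]
        field_simp
        have := sin_sq_add_cos_sq φ
        linear_combination (2 * α * sin ((1 + α) * φ)) * this
      rw [e]
      refine div_nonneg ?_ (by positivity)
      have := mul_sin_le_sin_mul (s := (1 - α) / (1 + α)) (u := (1 + α) * φ)
        (div_nonneg (by linarith) (by linarith)) (by rw [div_le_one (by linarith)]; linarith)
        (by nlinarith [h.1]) (by nlinarith [h.1, h.2])
      rw [show (1 - α) / (1 + α) * ((1 + α) * φ) = (1 - α) * φ by field_simp, div_mul_eq_mul_div,
        div_le_iff₀ (by linarith)] at this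
      linarith
  have hexp : ∀ φ ∈ Ioo 0 (π / 2), saddleRatio α φ =
      exp (log (sin ((1 + α) * φ)) - log (sin φ) - α * log (cos φ)) := by
    intro φ h
    rw [exp_sub, exp_sub, exp_log (ht φ h), exp_log (hs φ h), mul_comm α,
      ← rpow_def_of_pos (hc φ h), saddleRatio, div_div]
  intro φ₁ h₁ φ₂ h₂ hle
  rw [hexp _ h₁, hexp _ h₂]
  exact exp_le_exp.2 (hmono h₁ h₂ hle)

theorem one_add_le_saddleRatio {α φ : ℝ} (hα : 0 < α) (hα1 : α ≤ 1) (h : φ ∈ Ioo 0 (π / 2)) :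
    1 + α ≤ saddleRatio α φ := by
  have hl : Tendsto (saddleRatio α) (𝓝[>] 0) (𝓝 (1 + α)) := by
    have f := tendsto_sin_ratio (a := 1 + α) (b := 1) one_ne_zero
    have g : Tendsto (fun φ => cos φ ^ α) (𝓝[>] 0) (𝓝 1) := by
      have : ContinuousAt (fun φ => cos φ ^ α) 0 :=
        continuous_cos.continuousAt.rpow_const (Or.inl (by simp))
      have h2 := this.tendsto
      simp only [cos_zero, one_rpow] at h2
      exact h2.mono_left nhdsWithin_le_nhds
    have := f.div g one_ne_zero
    simp only [one_mul, div_one] at this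
    exact this.congr fun φ => by simp [saddleRatio, div_div]
  refine le_of_tendsto hl ?_
  filter_upwards [Ioo_mem_nhdsGT h.1] with ψ hψ
  exact saddleRatio_monotoneOn hα hα1 ⟨hψ.1, hψ.2.trans h.2⟩ h hψ.2.le

/-- The square of the gap at the point `σ e^{iφ} / cos φ`, where `q = σ ^ (-α)`. -/
def lineGapSq (α q φ : ℝ) : ℝ := (q * cos φ ^ α) ^ 2 - 2 * (q * cos φ ^ α) * cos (α * φ) + 1

theorem lineGapSq_hasDerivAt {α q φ : ℝ} (h : 0 < cos φ) :
    HasDerivAt (lineGapSq α q)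
      (2 * α * q * cos φ ^ (α - 1) * (sin ((1 + α) * φ) - q * cos φ ^ α * sin φ)) φ := by
  have h1 : HasDerivAt (fun φ => q * cos φ ^ α) (q * (-sin φ * α * cos φ ^ (α - 1))) φ :=
    ((hasDerivAt_cos φ).rpow_const (Or.inl h.ne')).const_mul q
  have h2 : HasDerivAt (fun φ => cos (α * φ)) (-sin (α * φ) * α) φ := by
    simpa using ((hasDerivAt_id φ).const_mul α).cos
  have h3 := ((h1.pow 2).sub ((h1.const_mul 2).mul h2)).add_const 1
  refine HasDerivAt.congr_deriv (f := lineGapSq α q) h3 ?_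
  have e : cos φ ^ α = cos φ ^ (α - 1) * cos φ := by
    rw [← rpow_add_one h.ne', sub_add_cancel]
  rw [show (1 + α) * φ = φ + α * φ by ring, sin_add, e]
  simp only [Nat.cast_ofNat, Nat.add_one_sub_one, pow_one]
  ring

theorem cos_pos_of_mem_Ico {φ : ℝ} (h : φ ∈ Ico 0 (π / 2)) : 0 < cos φ :=
  cos_pos_of_mem_Ioo ⟨by linarith [h.1, Real.pi_pos], h.2⟩

theorem lineGapSq_deriv_nonneg {α q φ : ℝ} (hα : 0 < α) (hq : 0 ≤ q) (h : φ ∈ Ioo 0 (π / 2))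
    (hle : q ≤ saddleRatio α φ) : 0 ≤ deriv (lineGapSq α q) φ := by
  have hc := cos_pos_of_mem_Ico ⟨h.1.le, h.2⟩
  have hs : 0 < sin φ := sin_pos_of_pos_of_lt_pi h.1 (by linarith [h.2, Real.pi_pos])
  rw [(lineGapSq_hasDerivAt hc).deriv]
  rw [saddleRatio, le_div_iff₀ (by positivity)] at hle
  refine mul_nonneg (by positivity) ?_
  linarith

theorem lineGapSq_deriv_nonpos {α q φ : ℝ} (hα : 0 < α) (hq : 0 ≤ q) (h : φ ∈ Ioo 0 (π / 2))
    (hle : saddleRatio α φ ≤ q) : deriv (lineGapSq α q) φ ≤ 0 := by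
  have hc := cos_pos_of_mem_Ico ⟨h.1.le, h.2⟩
  have hs : 0 < sin φ := sin_pos_of_pos_of_lt_pi h.1 (by linarith [h.2, Real.pi_pos])
  rw [(lineGapSq_hasDerivAt hc).deriv]
  rw [saddleRatio, div_le_iff₀ (by positivity)] at hle
  refine mul_nonpos_of_nonneg_of_nonpos (by positivity) ?_
  linarith

/-- Such a `q` lies below every saddle ratio, so the gap grows with the angle and is smallest on the
real axis. -/
theorem sub_one_sq_le_lineGapSq {α q φ : ℝ} (hα : 0 < α) (hα1 : α ≤ 1) (hq : 0 ≤ q)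
    (hq1 : q ≤ 1 + α) (h : φ ∈ Ico 0 (π / 2)) : (q - 1) ^ 2 ≤ lineGapSq α q φ := by
  have hm : MonotoneOn (lineGapSq α q) (Ico 0 (π / 2)) := by
    refine monotoneOn_of_deriv_nonneg (convex_Ico _ _) (fun φ h =>
      (lineGapSq_hasDerivAt (cos_pos_of_mem_Ico h)).continuousAt.continuousWithinAt) ?_ ?_ <;>
      rw [interior_Ico]
    · exact fun φ h => (lineGapSq_hasDerivAt
        (cos_pos_of_mem_Ico ⟨h.1.le, h.2⟩)).differentiableAt.differentiableWithinAt
    · exact fun φ h => lineGapSq_deriv_nonneg hα hq h (hq1.trans (one_add_le_saddleRatio hα hα1 h))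
  have h0 := hm ⟨le_rfl, by linarith [Real.pi_pos]⟩ h h.1
  refine le_trans (le_of_eq ?_) h0
  simp [lineGapSq]
  ring

theorem lineGapSq_saddle {α θ : ℝ} (hθ : θ ∈ Ioo 0 (π / 2)) :
    lineGapSq α (saddleRatio α θ) θ = (sin (α * θ) / sin θ) ^ 2 := by
  have hc := cos_pos_of_mem_Ico ⟨hθ.1.le, hθ.2⟩
  have hs : 0 < sin θ := sin_pos_of_pos_of_lt_pi hθ.1 (by linarith [hθ.2, Real.pi_pos])
  have hcα : 0 < cos θ ^ α := rpow_pos_of_pos hc _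
  have e : saddleRatio α θ * cos θ ^ α = sin ((1 + α) * θ) / sin θ := by
    rw [saddleRatio]; field_simp
  rw [lineGapSq, e, show (1 + α) * θ = θ + α * θ by ring, sin_add]
  field_simp
  have h1 := sin_sq_add_cos_sq θ
  have h2 := sin_sq_add_cos_sq (α * θ)
  linear_combination (sin (α * θ)) ^ 2 * h1 - (sin θ) ^ 2 * h2

/-- Since `saddleRatio` is monotone, the derivative is nonpositive before `θ` and nonnegative after
it, so `θ` is a global minimum. -/
theorem lineGapSq_saddle_le {α θ φ : ℝ} (hα : 0 < α) (hα1 : α ≤ 1) (hθ : θ ∈ Ioo 0 (π / 2))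
    (h : φ ∈ Ico 0 (π / 2)) :
    (sin (α * θ) / sin θ) ^ 2 ≤ lineGapSq α (saddleRatio α θ) φ := by
  rw [← lineGapSq_saddle hθ]
  have hq : 0 ≤ saddleRatio α θ := by linarith [one_add_le_saddleRatio hα hα1 hθ]
  rcases le_total φ θ with hle | hle
  · have hm : AntitoneOn (lineGapSq α (saddleRatio α θ)) (Icc 0 θ) := by
      refine antitoneOn_of_deriv_nonpos (convex_Icc _ _) (fun φ h => (lineGapSq_hasDerivAt
        (cos_pos_of_mem_Ico ⟨h.1, h.2.trans_lt hθ.2⟩)).continuousAt.continuousWithinAt) ?_ ?_ <;>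
        rw [interior_Icc]
      · exact fun φ h => (lineGapSq_hasDerivAt (cos_pos_of_mem_Ico
          ⟨h.1.le, h.2.trans hθ.2⟩)).differentiableAt.differentiableWithinAt
      · exact fun φ h => lineGapSq_deriv_nonpos hα hq ⟨h.1, h.2.trans hθ.2⟩
          (saddleRatio_monotoneOn hα hα1 ⟨h.1, h.2.trans hθ.2⟩ hθ h.2.le)
    exact hm ⟨h.1, hle⟩ ⟨hθ.1.le, le_rfl⟩ hle
  · have hm : MonotoneOn (lineGapSq α (saddleRatio α θ)) (Ico θ (π / 2)) := by
      refine monotoneOn_of_deriv_nonneg (convex_Ico _ _) (fun φ h => (lineGapSq_hasDerivAt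
        (cos_pos_of_mem_Ico ⟨hθ.1.le.trans h.1, h.2⟩)).continuousAt.continuousWithinAt) ?_ ?_ <;>
        rw [interior_Ico]
      · exact fun φ h => (lineGapSq_hasDerivAt (cos_pos_of_mem_Ico
          ⟨(hθ.1.trans h.1).le, h.2⟩)).differentiableAt.differentiableWithinAt
      · exact fun φ h => lineGapSq_deriv_nonneg hα hq ⟨hθ.1.trans h.1, h.2⟩
          (saddleRatio_monotoneOn hα hα1 hθ ⟨hθ.1.trans h.1, h.2⟩ h.1.le)
    exact hm ⟨le_rfl, hθ.2⟩ ⟨hle, h.2⟩ hle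

theorem gap_sq {α : ℝ} {v : ℂ} :
    gap α v ^ 2 = (‖v‖ ^ (-α)) ^ 2 - 2 * ‖v‖ ^ (-α) * cos (α * v.arg) + 1 := by
  rw [gap, ← Complex.normSq_eq_norm_sq, Complex.normSq_apply, Complex.sub_re, Complex.sub_im,
    Complex.cpow_ofReal_re, Complex.cpow_ofReal_im, Complex.one_re, Complex.one_im,
    show v.arg * -α = -(α * v.arg) by ring, cos_neg, sin_neg]
  have := sin_sq_add_cos_sq (α * v.arg)
  linear_combination (‖v‖ ^ (-α)) ^ 2 * this

theorem gap_sq_line {α σ : ℝ} (hσ : 0 < σ) {v : ℂ} (hv : v.re = σ) :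
    gap α v ^ 2 = lineGapSq α (σ ^ (-α)) |v.arg| := by
  have hv0 : v ≠ 0 := fun h => by simp [h] at hv; linarith
  have hN : 0 < ‖v‖ := norm_pos_iff.2 hv0
  have hc : cos v.arg = σ / ‖v‖ := by rw [Complex.cos_arg hv0, hv]
  have e : σ ^ (-α) * (σ / ‖v‖) ^ α = ‖v‖ ^ (-α) := by
    rw [div_rpow hσ.le hN.le, rpow_neg hσ.le, rpow_neg hN.le]
    have := rpow_pos_of_pos hσ α
    field_simp
  have e2 : cos (α * |v.arg|) = cos (α * v.arg) := by
    rcases abs_cases v.arg with h | h <;> rw [h.1]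
    rw [mul_neg, cos_neg]
  rw [gap_sq, lineGapSq, cos_abs, e2, hc, e]

theorem abs_arg_mem {v : ℂ} (hv : 0 < v.re) : |v.arg| ∈ Ico 0 (π / 2) :=
  ⟨abs_nonneg _, Complex.abs_arg_lt_pi_div_two_iff.2 (Or.inl hv)⟩

theorem sub_one_le_gap {α σ : ℝ} (hα : 0 < α) (hα1 : α ≤ 1) (hσ : 0 < σ)
    (h : σ ^ (-α) ≤ 1 + α) {v : ℂ} (hv : v.re = σ) : σ ^ (-α) - 1 ≤ gap α v := by
  refine (le_abs_self _).trans (abs_le_of_sq_le_sq ?_ (norm_nonneg _))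
  rw [gap_sq_line hσ hv]
  exact sub_one_sq_le_lineGapSq hα hα1 (rpow_pos_of_pos hσ _).le h (abs_arg_mem (hv ▸ hσ))

theorem saddle_le_gap {α σ θ : ℝ} (hα : 0 < α) (hα1 : α ≤ 1) (hσ : 0 < σ)
    (hθ : θ ∈ Ioo 0 (π / 2)) (h : σ ^ (-α) = saddleRatio α θ) {v : ℂ} (hv : v.re = σ) :
    sin (α * θ) / sin θ ≤ gap α v := by
  refine (le_abs_self _).trans (abs_le_of_sq_le_sq ?_ (norm_nonneg _))
  rw [gap_sq_line hσ hv, h]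
  exact lineGapSq_saddle_le hα hα1 hθ (abs_arg_mem (hv ▸ hσ))

/-! ### The contour bound with constants uniform in `α`. -/

/-- `1/Γ` is entire, hence bounded on compact intervals, including near `0`. -/
theorem exists_inv_Gamma_bound (B : ℝ) : ∃ C > 0, ∀ t ∈ Ioc 0 B, 1 / Gamma t ≤ C := by
  have hc : Continuous fun t : ℝ => (Complex.Gamma (t : ℂ))⁻¹ :=
    Complex.differentiable_one_div_Gamma.continuous.comp Complex.continuous_ofReal
  obtain ⟨C, hC⟩ := (isCompact_Icc (a := (0 : ℝ)) (b := B)).exists_bound_of_continuousOn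
    hc.continuousOn
  refine ⟨max C 1, by positivity, fun t ht => le_trans ?_ (le_max_left _ _)⟩
  have := hC t ⟨ht.1.le, ht.2⟩
  rwa [Complex.Gamma_ofReal, ← Complex.ofReal_inv, Complex.norm_real, Real.norm_eq_abs, abs_of_pos
    (inv_pos.2 (Gamma_pos_of_pos ht.1)), inv_eq_one_div] at this

theorem rpow_le_rpow_of_bounds {N Λ e E : ℝ} (hN : 0 < N) (h1 : N ≤ Λ) (h2 : 1 / N ≤ Λ)
    (he : |e| ≤ E) : N ^ e ≤ Λ ^ E := by
  have hE : 0 ≤ E := (abs_nonneg e).trans he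
  rcases le_total 1 N with h | h
  · exact (rpow_le_rpow_of_exponent_le h ((le_abs_self e).trans he)).trans
      (rpow_le_rpow hN.le h1 hE)
  · refine (rpow_le_rpow_of_exponent_ge hN h (neg_le_of_abs_le he)).trans ?_
    rw [rpow_neg hN.le, ← inv_rpow hN.le, inv_eq_one_div]
    exact rpow_le_rpow (by positivity) h2 hE

/-- The threshold `e` serves every `α`, as `e^α ≥ 1 + α`. Equivalently `α N^{-α} ≤ 1 - N^{-α}`,
which later bounds the derivative of `v^{-α}` by the gap. -/
theorem rpow_neg_le_inv_one_add {α N : ℝ} (hα : 0 < α) (hN : exp 1 ≤ N) :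
    N ^ (-α) ≤ 1 / (1 + α) := by
  have h0 : 0 < N := (exp_pos 1).trans_le hN
  rw [rpow_neg h0.le, inv_eq_one_div]
  refine one_div_le_one_div_of_le (by linarith) ?_
  calc 1 + α ≤ exp α := by linarith [add_one_le_exp α]
    _ = exp 1 ^ α := by rw [← exp_mul, one_mul]
    _ ≤ N ^ α := rpow_le_rpow (exp_pos 1).le hN hα.le

theorem one_sub_le_gap {α : ℝ} {v : ℂ} : 1 - ‖v‖ ^ (-α) ≤ gap α v := by
  have := norm_sub_norm_le (1 : ℂ) (v ^ ((-α : ℝ) : ℂ))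
  rwa [norm_one, Complex.norm_cpow_real] at this

theorem half_le_gap {α : ℝ} (hα : 0 < α) (hα1 : α ≤ 1) {v : ℂ} (hv : exp 1 ≤ ‖v‖) :
    α / 2 ≤ gap α v := by
  refine le_trans ?_ one_sub_le_gap
  have h := rpow_neg_le_inv_one_add hα hv
  have : 1 / (1 + α) ≤ 1 - α / 2 := by
    rw [div_le_iff₀ (by linarith)]
    nlinarith
  linarith

/-- Beyond radius `T` the derivative of `v^{-α}` has modulus at most `α T^{-α}/T ≤ (1 - T^{-α})/T ≤
gap α v' / T`. The mean value inequality then bounds the relative change of the gap, with a rate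
`1/T` free of `α`. -/
theorem gap_le_mul_exp {α T : ℝ} (hα : 0 < α) (hT : exp 1 ≤ T) {s : Set ℂ}
    (hs : Convex ℝ s) (hre : ∀ z ∈ s, 0 < z.re) (hn : ∀ z ∈ s, T ≤ ‖z‖) {v v' : ℂ} (hv : v ∈ s)
    (hv' : v' ∈ s) : gap α v ≤ gap α v' * exp (‖v - v'‖ / T) := by
  have hT0 : 0 < T := (exp_pos 1).trans_le hT
  have hb : ∀ z ∈ s, ‖((-α : ℝ) : ℂ) * z ^ (((-α : ℝ) : ℂ) - 1)‖ ≤ gap α v' / T := by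
    intro z hz
    have e : (((-α : ℝ) : ℂ) - 1) = ((-α - 1 : ℝ) : ℂ) := by push_cast; rfl
    rw [e, norm_mul, Complex.norm_cpow_real, Complex.norm_real, Real.norm_eq_abs, abs_neg,
      abs_of_pos hα]
    have h1 : ‖z‖ ^ (-α - 1) ≤ T ^ (-α - 1) :=
      rpow_le_rpow_of_nonpos hT0 (hn z hz) (by linarith)
    rw [rpow_sub_one hT0.ne'] at h1
    have h2 := rpow_neg_le_inv_one_add hα hT
    rw [le_div_iff₀ (by linarith)] at h2
    have h3 : ‖v'‖ ^ (-α) ≤ T ^ (-α) := rpow_le_rpow_of_nonpos hT0 (hn v' hv') (by linarith)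
    have h4 := one_sub_le_gap (α := α) (v := v')
    calc α * ‖z‖ ^ (-α - 1) ≤ α * (T ^ (-α) / T) := by gcongr
      _ = α * T ^ (-α) / T := by ring
      _ ≤ gap α v' / T := by gcongr; nlinarith
  have hd : ∀ z ∈ s, HasDerivWithinAt (fun z : ℂ => z ^ ((-α : ℝ) : ℂ))
      (((-α : ℝ) : ℂ) * z ^ (((-α : ℝ) : ℂ) - 1)) s z := by
    intro z hz
    have := (hasDerivAt_id z).cpow_const (c := ((-α : ℝ) : ℂ)) (Or.inl (hre z hz))
    simpa using this.hasDerivWithinAt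
  have hmv := hs.norm_image_sub_le_of_norm_hasDerivWithin_le hd hb hv hv'
  have htri : gap α v ≤ gap α v' + ‖v' ^ ((-α : ℝ) : ℂ) - v ^ ((-α : ℝ) : ℂ)‖ := by
    unfold gap
    refine le_trans (le_of_eq ?_) (norm_add_le _ _)
    congr 1
    ring
  rw [norm_sub_rev v' v] at hmv
  calc gap α v ≤ gap α v' + gap α v' / T * ‖v - v'‖ := by linarith
    _ = gap α v' * (‖v - v'‖ / T + 1) := by ring
    _ ≤ _ := mul_le_mul_of_nonneg_left (add_one_le_exp _) (norm_nonneg _)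

/-- A point of a horizontal side is compared with its projection to the line, at rate `c/2`. A point
of the right side is reached through the corner `R + iT`; the vertical move has length at most `2T ≤
R - σ` and costs another `c/2`. -/
theorem le_gap_mul_exp_of_boundary {α c σ m T R : ℝ} (hα : 0 < α) (hc : 0 < c) (hσ : 0 < σ)
    (hT : exp 1 ≤ T) (hTc : 2 / c ≤ T) (hR : 2 * T ≤ R - σ)
    (hm : ∀ v : ℂ, v.re = σ → m ≤ gap α v) {v : ℂ} (h1 : σ ≤ v.re) (h3 : |v.im| ≤ T)
    (h4 : v.re = σ ∨ v.re = R ∨ |v.im| = T) : m ≤ gap α v * exp (c * (v.re - σ)) := by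
  have hT0 : 0 < T := (exp_pos 1).trans_le hT
  have hTc' : 1 / T ≤ c / 2 := by
    rw [div_le_iff₀ hc] at hTc
    rw [div_le_div_iff₀ hT0 two_pos]
    linarith
  have hor : ∀ z : ℂ, σ ≤ z.re → |z.im| = T → m ≤ gap α z * exp (c / 2 * (z.re - σ)) := by
    intro z hz hzT
    have h := gap_le_mul_exp (s := {w : ℂ | 0 < w.re ∧ w.im = z.im}) (α := α) hα hT
      ((convex_halfSpace_re_gt 0).inter (s := {w : ℂ | 0 < w.re}) (t := {w : ℂ | w.im = z.im})
        ((convex_singleton z.im).linear_preimage Complex.imLm)) (fun w hw => hw.1)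
      (fun w hw => by rw [← hzT, ← hw.2]; exact Complex.abs_im_le_norm w)
      (v := ⟨σ, z.im⟩) (v' := z) ⟨hσ, rfl⟩ ⟨hσ.trans_le hz, rfl⟩
    refine (hm _ rfl).trans (h.trans ?_)
    refine mul_le_mul_of_nonneg_left (exp_le_exp.2 ?_) (norm_nonneg _)
    have e : ‖(⟨σ, z.im⟩ : ℂ) - z‖ = z.re - σ := by
      have : (⟨σ, z.im⟩ : ℂ) - z = ((σ - z.re : ℝ) : ℂ) := by
        apply Complex.ext <;> simp
      rw [this, Complex.norm_real, Real.norm_eq_abs, abs_sub_comm, abs_of_nonneg (by linarith)]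
    rw [e, div_eq_mul_one_div, mul_comm]
    exact mul_le_mul_of_nonneg_right hTc' (by linarith)
  rcases h4 with h | h | h
  · rw [h, sub_self, mul_zero, exp_zero, mul_one]
    exact hm v h
  · have hc1 := hor ⟨R, T⟩ (by simp only; linarith) (abs_of_pos hT0)
    have h5 := gap_le_mul_exp (s := {w : ℂ | T ≤ w.re}) (α := α) hα hT
      (convex_halfSpace_re_ge T) (fun w hw => hT0.trans_le hw)
      (fun w hw => le_trans hw (Complex.re_le_norm w))
      (v := ⟨R, T⟩) (v' := v) (by simp only [mem_ofPred_eq]; linarith)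
      (by simp only [mem_ofPred_eq]; linarith)
    have e : ‖(⟨R, T⟩ : ℂ) - v‖ ≤ R - σ := by
      have : (⟨R, T⟩ : ℂ) - v = ((T - v.im : ℝ) : ℂ) * Complex.I := by
        apply Complex.ext <;> simp [h]
      rw [this, norm_mul, Complex.norm_I, mul_one, Complex.norm_real, Real.norm_eq_abs]
      have := abs_le.1 h3
      exact (abs_le.2 ⟨by linarith, by linarith⟩).trans hR
    have h6 : ‖(⟨R, T⟩ : ℂ) - v‖ / T ≤ c / 2 * (R - σ) := by
      rw [div_eq_mul_one_div, mul_comm]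
      exact mul_le_mul hTc' e (norm_nonneg _) (by positivity)
    simp only at hc1
    calc m ≤ gap α ⟨R, T⟩ * exp (c / 2 * (R - σ)) := hc1
      _ ≤ gap α v * exp (c / 2 * (R - σ)) * exp (c / 2 * (R - σ)) := by
        refine mul_le_mul_of_nonneg_right (h5.trans ?_) (exp_pos _).le
        exact mul_le_mul_of_nonneg_left (exp_le_exp.2 h6) (norm_nonneg _)
      _ = gap α v * exp (c * (v.re - σ)) := by
        rw [mul_assoc, ← exp_add, h]
        congr 2
        ring
  · refine (hor v h1 h).trans (mul_le_mul_of_nonneg_left (exp_le_exp.2 ?_) (norm_nonneg _))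
    nlinarith

/-- The contour bound along the line `Re v = σ`, with uniform constant. -/
theorem exists_abs_W_le (β : ℝ) {s₀ η₁ c c' : ℝ} (hs₀ : 0 < s₀) (hη : η₁ < 1) (hc : 0 < c)
    (hc' : 0 < c') :
    ∃ K > 0, ∀ α : ℝ, 0 < α → α ≤ 1 → 1 - 1 / α ≤ β → ∀ σ ∈ Icc s₀ η₁, ∀ (n : ℕ) (x m : ℝ),
      0 < x → c * n ≤ x ^ (1 / α) → c' * α ≤ m → (∀ v : ℂ, v.re = σ → m ≤ gap α v) →
        |W α β n x| ≤ K * (x ^ betaIdx α β * exp (-(σ * x ^ (1 / α))) / m ^ n) := by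
  obtain ⟨C, hC0, hC⟩ := exists_inv_Gamma_bound (1 + |β|)
  obtain ⟨T, hTdef⟩ : ∃ T, T = max (exp 1) (2 / c) := ⟨_, rfl⟩
  have hT : exp 1 ≤ T := hTdef ▸ le_max_left _ _
  have hTc : 2 / c ≤ T := hTdef ▸ le_max_right _ _
  have hT1 : 1 < T := (by linarith [add_one_le_exp (1 : ℝ)] : (1 : ℝ) < exp 1).trans_le hT
  have hT0 : 0 < T := by linarith
  -- As `σ < 1`, this gives `2T ≤ R - σ`.
  obtain ⟨R, hR⟩ : ∃ R, R = 2 * T + 1 := ⟨_, rfl⟩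
  have hR0 : 0 < R := by linarith
  obtain ⟨Λ, hΛ⟩ : ∃ Λ, Λ = max (1 / s₀) (R + T) := ⟨_, rfl⟩
  have hΛ1 : 1 / s₀ ≤ Λ := hΛ ▸ le_max_left _ _
  have hΛ2 : R + T ≤ Λ := hΛ ▸ le_max_right _ _
  obtain ⟨κ, hκ⟩ : ∃ κ, κ = min c' (1 / 2) := ⟨_, rfl⟩
  have hκ0 : 0 < κ := hκ ▸ lt_min hc' (by norm_num)
  have hκ1 : κ ≤ c' := hκ ▸ min_le_left _ _
  have hκ2 : κ ≤ 1 / 2 := hκ ▸ min_le_right _ _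
  have hΛ0 : 0 < Λ := by linarith
  have hP : 0 < Λ ^ (|β| + 1) := rpow_pos_of_pos hΛ0 _
  refine ⟨C / κ * Λ ^ (|β| + 1) * (2 * R + 4 * T) / (2 * π), by positivity, ?_⟩
  intro α hα hα1 hβ σ hσ n x m hx hy hm hgap
  have hσ0 : 0 < σ := hs₀.trans_le hσ.1
  have hm0 : 0 < m := (mul_pos hc' hα).trans_le hm
  have hG := gamma_arg_pos hα hβ
  have hαβ : α * β ≤ |β| := by
    calc α * β ≤ α * |β| := mul_le_mul_of_nonneg_left (le_abs_self β) hα.le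
      _ ≤ 1 * |β| := mul_le_mul_of_nonneg_right hα1 (abs_nonneg β)
      _ = |β| := one_mul _
  have hαβ' : -|β| ≤ α * β := by
    have h1 : α * -β ≤ α * |β| := mul_le_mul_of_nonneg_left (neg_le_abs β) hα.le
    have h2 : α * |β| ≤ 1 * |β| := mul_le_mul_of_nonneg_right hα1 (abs_nonneg β)
    linarith
  have hCG := hC (α * β + 1) ⟨hG, by linarith⟩
  have hbound := abs_W_le_of_rect hα hα1 hβ (n := n) hx (a := σ) (b := R) (T := T)
    (M := Λ ^ (|β| + 1) * (1 / (κ * α)) * (exp (-(σ * x ^ (1 / α))) / m ^ n)) hσ0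
    (hσ.2.trans_lt hη) (by linarith) hT0 (by
      intro v h1 h2 h3 h4
      have hre : 0 < v.re := hσ0.trans_le h1
      have hN : 0 < ‖v‖ := hre.trans_le (Complex.re_le_norm v)
      have b1 : ‖v‖ ^ (α * β - α) ≤ Λ ^ (|β| + 1) := by
        refine rpow_le_rpow_of_bounds hN ?_ ?_ (abs_le.2 ⟨by linarith, by linarith⟩)
        · have := Complex.norm_le_abs_re_add_abs_im v
          rw [abs_of_pos hre] at this
          linarith
        · refine le_trans (one_div_le_one_div_of_le hs₀ ?_) hΛ1
          exact hσ.1.trans (h1.trans (Complex.re_le_norm v))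
      -- One of the `n + 1` gap factors is bounded crudely. Its cost `1/α` cancels the factor `α`
      -- coming from `p'`, which keeps the constant uniform as `α → 0`.
      have b2 : κ * α ≤ gap α v := by
        have far : T ≤ ‖v‖ → κ * α ≤ gap α v := by
          intro h
          have := half_le_gap hα hα1 (hT.trans h)
          nlinarith
        rcases h4 with h | h | h
        · refine le_trans ?_ (hm.trans (hgap v h))
          exact mul_le_mul_of_nonneg_right hκ1 hα.le
        · exact far (by linarith [Complex.re_le_norm v])
        · exact far (h ▸ Complex.abs_im_le_norm v)
      have hg0 : 0 < gap α v := (mul_pos hκ0 hα).trans_le b2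
      -- The gap may lose `exp(c n (Re v - σ))`, which `x^{1/α} ≥ c n` lets the exponential repay.
      have b3 : exp (-(x ^ (1 / α) * v.re)) / gap α v ^ n ≤ exp (-(σ * x ^ (1 / α))) / m ^ n := by
        have h5 := le_gap_mul_exp_of_boundary hα hc hσ0 hT hTc
          (by linarith [hσ.2] : 2 * T ≤ R - σ) hgap h1 h3 h4
        have h6 := pow_le_pow_left₀ hm0.le h5 n
        rw [mul_pow, ← exp_nat_mul] at h6
        have h7 : exp (n * (c * (v.re - σ))) ≤ exp (x ^ (1 / α) * (v.re - σ)) := by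
          refine exp_le_exp.2 ?_
          nlinarith
        rw [div_le_div_iff₀ (pow_pos hg0 n) (pow_pos hm0 n)]
        calc exp (-(x ^ (1 / α) * v.re)) * m ^ n
            ≤ exp (-(x ^ (1 / α) * v.re)) * (gap α v ^ n * exp (x ^ (1 / α) * (v.re - σ))) :=
              mul_le_mul_of_nonneg_left (h6.trans
                (mul_le_mul_of_nonneg_left h7 (pow_pos hg0 n).le)) (exp_pos _).le
          _ = exp (-(x ^ (1 / α) * v.re)) * exp (x ^ (1 / α) * (v.re - σ)) * gap α v ^ n := by ring
          _ = exp (-(σ * x ^ (1 / α))) * gap α v ^ n := by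
            rw [← exp_add]
            congr 2
            ring
      calc ‖v‖ ^ (α * β - α) * exp (-(x ^ (1 / α) * v.re)) / gap α v ^ (n + 1)
          = ‖v‖ ^ (α * β - α) * (1 / gap α v) * (exp (-(x ^ (1 / α) * v.re)) / gap α v ^ n) := by
            rw [pow_succ]
            field_simp
        _ ≤ _ := mul_le_mul (mul_le_mul b1 (one_div_le_one_div_of_le (mul_pos hκ0 hα) b2)
            (by positivity) hP.le) b3 (by positivity) (by positivity))
  refine hbound.trans ?_
  have hxβ : 0 < x ^ betaIdx α β := rpow_pos_of_pos hx _
  have hmn := pow_pos hm0 n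
  calc x ^ betaIdx α β * (α / Gamma (α * β + 1)) *
        (Λ ^ (|β| + 1) * (1 / (κ * α)) * (exp (-(σ * x ^ (1 / α))) / m ^ n)) *
        (2 * (R - σ) + 4 * T) / (2 * π)
      = 1 / Gamma (α * β + 1) * (2 * (R - σ) + 4 * T) * (1 / κ * Λ ^ (|β| + 1) / (2 * π) *
        (x ^ betaIdx α β * exp (-(σ * x ^ (1 / α))) / m ^ n)) := by
        have := Gamma_pos_of_pos hG
        field_simp
    _ ≤ C * (2 * R + 4 * T) * (1 / κ * Λ ^ (|β| + 1) / (2 * π) *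
        (x ^ betaIdx α β * exp (-(σ * x ^ (1 / α))) / m ^ n)) := by
        refine mul_le_mul_of_nonneg_right (mul_le_mul hCG ?_ ?_ hC0.le) (by positivity)
        · linarith
        · linarith [hσ.2]
    _ = _ := by ring

/-! ### The double saddle point and the middle range. -/

section Constants

variable {α : ℝ}

/-- The abscissa `(1 + α) ^ (-1/α)` of the double saddle point. -/
def saddleAbscissa (α : ℝ) : ℝ := (1 + α) ^ (-(1 / α))

theorem saddleAbscissa_pos (hα : 0 < α) : 0 < saddleAbscissa α :=
  rpow_pos_of_pos (by linarith) _

theorem exp_neg_one_le_saddleAbscissa (hα : 0 < α) : exp (-1) ≤ saddleAbscissa α := by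
  have h : (exp α) ^ (-(1 / α)) ≤ (1 + α) ^ (-(1 / α)) :=
    rpow_le_rpow_of_nonpos (by linarith) (by linarith [add_one_le_exp α])
      (neg_nonpos.2 (by positivity))
  rwa [← exp_mul, show α * -(1 / α) = -1 by field_simp] at h

theorem saddleAbscissa_le_half (hα : 0 < α) (hα1 : α ≤ 1) : saddleAbscissa α ≤ 1 / 2 := by
  have h := one_add_mul_self_le_rpow_one_add (s := α) (by linarith) (p := 1 / α)
    ((one_le_div hα).2 hα1)
  rw [one_div_mul_cancel hα.ne'] at h
  rw [saddleAbscissa, rpow_neg (by linarith), ← one_div]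
  exact one_div_le_one_div_of_le two_pos (by linarith)

theorem saddleAbscissa_lt_half (hα : 0 < α) (hα1 : α < 1) : saddleAbscissa α < 1 / 2 := by
  have h := one_add_mul_self_lt_rpow_one_add (s := α) (by linarith) hα.ne' (p := 1 / α)
    ((one_lt_div hα).2 hα1)
  rw [one_div_mul_cancel hα.ne'] at h
  rw [saddleAbscissa, rpow_neg (by linarith), ← one_div]
  exact one_div_lt_one_div_of_lt two_pos (by linarith)

theorem saddleAbscissa_rpow_neg (hα : 0 < α) : saddleAbscissa α ^ (-α) = 1 + α := by
  rw [saddleAbscissa, ← rpow_mul (by linarith), show -(1 / α) * -α = 1 by field_simp, rpow_one]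

theorem rpow_mul_saddleAbscissa (hα : 0 < α) :
    (1 + α) ^ ((1 + α) / α) * saddleAbscissa α = 1 + α := by
  rw [saddleAbscissa, ← rpow_add (by linarith),
    show (1 + α) / α + -(1 / α) = 1 by field_simp; ring, rpow_one]

theorem Abar_rpow (hα : 0 < α) : Abar α ^ (1 / α) = (1 + α) ^ ((1 + α) / α) := by
  rw [Abar, ← rpow_mul (by linarith)]
  congr 1
  ring

theorem Abar_pos (hα : 0 < α) : 0 < Abar α := rpow_pos_of_pos (by linarith) _

theorem mul_rpow_rpow_inv (hα : 0 < α) {A : ℝ} (hA : 0 ≤ A) (n : ℕ) :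
    (A * (n : ℝ) ^ α) ^ (1 / α) = A ^ (1 / α) * n := by
  have hn : (0 : ℝ) ≤ n := n.cast_nonneg
  rw [mul_rpow hA (rpow_nonneg hn _), ← rpow_mul hn, mul_one_div_cancel hα.ne', rpow_one]

theorem inv_pow_eq_exp {m : ℝ} (hm : 0 < m) (n : ℕ) : 1 / m ^ n = exp (n * -log m) := by
  rw [mul_neg, exp_neg, exp_nat_mul, exp_log hm, one_div]

theorem mem_E_iff {η : ℝ} : η ∈ E α ↔ saddleAbscissa α ≤ η ∧ η < 1 := by
  rw [E, saddleAbscissa, add_comm, mem_Ico]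

theorem rpow_neg_le_one_add (hα : 0 < α) {η : ℝ} (h : saddleAbscissa α ≤ η) :
    η ^ (-α) ≤ 1 + α := by
  rw [← saddleAbscissa_rpow_neg hα]
  exact rpow_le_rpow_of_nonpos (saddleAbscissa_pos hα) h (by linarith)

/-- From `e^t ≥ 1 + t` at `t = -α log η`; it supplies the lower bound linear in `α` required by
`exists_abs_W_le`. -/
theorem neg_log_mul_le {η η₁ : ℝ} (hα : 0 < α) (hη : 0 < η) (h : η ≤ η₁) :
    -log η₁ * α ≤ η ^ (-α) - 1 := by
  have h1 := log_le_log hη h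
  have h2 := add_one_le_exp (log η * -α)
  rw [← rpow_def_of_pos hη] at h2
  nlinarith

/-- The bound along the line through the double saddle point. -/
theorem exists_abs_W_le_saddleAbscissa (β : ℝ) {c : ℝ} (hc : 0 < c) :
    ∃ K > 0, ∀ α : ℝ, 0 < α → α ≤ 1 → 1 - 1 / α ≤ β → ∀ (n : ℕ) (x : ℝ), 0 < x →
      c * n ≤ x ^ (1 / α) → |W α β n x| ≤
        K * (x ^ betaIdx α β * exp (-(saddleAbscissa α * x ^ (1 / α))) * exp (n * -log α)) := by
  obtain ⟨K, hK, h⟩ := exists_abs_W_le β (s₀ := exp (-1)) (η₁ := 1 / 2) (c' := 1) (exp_pos _)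
    (by norm_num) hc one_pos
  refine ⟨K, hK, fun α hα hα1 hβ n x hx hy => ?_⟩
  have := h α hα hα1 hβ (saddleAbscissa α)
    ⟨exp_neg_one_le_saddleAbscissa hα, saddleAbscissa_le_half hα hα1⟩ n x α hx hy (by simp)
    fun v hv => by
      have := sub_one_le_gap hα hα1 (saddleAbscissa_pos hα) (saddleAbscissa_rpow_neg hα).le hv
      rw [saddleAbscissa_rpow_neg hα] at this
      linarith
  rwa [div_eq_mul_one_div, inv_pow_eq_exp hα] at this

/-- With `ρ = saddleAbscissa α ≤ 1/2` and `y = x^{1/α}`, replacing `e^{-ρy}` by `e^{-y/2}` costs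
`e^{(1/2-ρ)y}`. This is controlled by `y ≤ (1+α)^{(1+α)/α} n`, and `ρ (1+α)^{(1+α)/α} = 1 + α`. -/
theorem exists_abs_W_le_middle (β : ℝ) {c : ℝ} (hc : 0 < c) :
    ∃ K > 0, ∀ α : ℝ, 0 < α → α ≤ 1 → 1 - 1 / α ≤ β → ∀ (n : ℕ) (x : ℝ), 0 < x →
      c * n ≤ x ^ (1 / α) → x < Abar α * (n : ℝ) ^ α → |W α β n x| ≤
        K * (x ^ betaIdx α β * exp (-(1 / 2) * x ^ (1 / α)) *
          exp (n * (-log α + 1 / 2 * (1 + α) ^ ((1 + α) / α) - 1 - α))) := by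
  obtain ⟨K, hK, h⟩ := exists_abs_W_le_saddleAbscissa β hc
  refine ⟨K, hK, fun α hα hα1 hβ n x hx hy hxA => (h α hα hα1 hβ n x hx hy).trans ?_⟩
  refine mul_le_mul_of_nonneg_left ?_ hK.le
  rw [mul_assoc, mul_assoc, ← exp_add, ← exp_add]
  refine mul_le_mul_of_nonneg_left (exp_le_exp.2 ?_) (rpow_nonneg hx.le _)
  have h1 : x ^ (1 / α) ≤ (1 + α) ^ ((1 + α) / α) * n := by
    rw [← Abar_rpow hα, ← mul_rpow_rpow_inv hα (Abar_pos hα).le]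
    exact rpow_le_rpow hx.le hxA.le (by positivity)
  have h2 := rpow_mul_saddleAbscissa hα
  have h3 := saddleAbscissa_le_half hα hα1
  have h4 := mul_le_mul_of_nonneg_left h1 (sub_nonneg.2 h3)
  linear_combination h4 - n * h2

/-- Makes `x^{1/α} ≥ (2/π) n` available for all `α` at once when `x > B̄_α n^α`. -/
theorem two_div_pi_rpow_le_Bbar (hα : 0 < α) : (2 / π) ^ α ≤ Bbar α := by
  have hp := Real.pi_pos
  have hu : 0 < π * α / (2 * (1 + α)) := by positivity
  have hu1 : π * α / (2 * (1 + α)) ≤ π * α / 2 := by gcongr; linarith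
  have hu2 : π * α / (2 * (1 + α)) < π := by
    rw [div_lt_iff₀ (by positivity)]
    nlinarith
  have hs := sin_pos_of_pos_of_lt_pi hu hu2
  have hs1 : sin (π * α / (2 * (1 + α))) ≤ π * α / 2 := (sin_le hu.le).trans hu1
  have hv : 0 < sin (π / (2 * (1 + α))) := by
    refine sin_pos_of_pos_of_lt_pi (by positivity) ?_
    rw [div_lt_iff₀ (by positivity)]
    nlinarith
  have h1 : 1 ≤ 1 / sin (π / (2 * (1 + α))) := by
    rw [le_div_iff₀ hv, one_mul]
    exact sin_le_one _
  calc (2 / π) ^ α = α ^ α * (1 / (π * α / 2) ^ α) := by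
        rw [← div_eq_mul_one_div, ← div_rpow hα.le (by positivity)]
        congr 1
        field_simp
    _ ≤ Bbar α := by
        unfold Bbar
        gcongr

end Constants

/-! ### The outer range and the exponent `H`. -/

section Outer

variable {α : ℝ}

/-- For `η ∈ E α` the line `Re v = η` has its smallest gap on the real axis. Otherwise `η` is below
the double saddle abscissa; that abscissa is used, and the surplus decay is converted by `x^{1/α} ≥
(1+α)^{(1+α)/α} n`. -/
theorem exists_abs_W_le_outer (β : ℝ) {η : ℝ} (hη : η < 1) :
    ∃ K > 0, ∀ α ∈ Ioo (0 : ℝ) 1, 1 - 1 / α ≤ β →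
      ∀ n : ℕ, 1 ≤ n → ∀ x : ℝ, Abar α * (n : ℝ) ^ α ≤ x →
        |W α β n x| ≤ K * (α ^ (-(5 / 2) : ℝ) * x ^ betaIdx α β * exp (-η * x ^ (1 / α)) *
          exp (n * H α η)) := by
  -- The cap at `1/2` keeps the logarithm meaningful for `η ≤ 0` and covers the double saddle
  -- abscissa.
  have hm1 : 1 / 2 ≤ max η (1 / 2) := le_max_right _ _
  have hm2 : max η (1 / 2) < 1 := max_lt hη (by norm_num)
  obtain ⟨K₁, hK₁, h₁⟩ := exists_abs_W_le β (s₀ := exp (-1)) (η₁ := max η (1 / 2)) (c := 1)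
    (c' := -log (max η (1 / 2))) (exp_pos _) hm2 one_pos
    (neg_pos.2 (log_neg (by linarith) hm2))
  obtain ⟨K₂, hK₂, h₂⟩ := exists_abs_W_le_saddleAbscissa β one_pos
  refine ⟨max K₁ K₂, by positivity, fun α ⟨hα, hα1⟩ hβ n hn x hx => ?_⟩
  have hn0 : (0 : ℝ) < n := by exact_mod_cast hn
  have hx0 : 0 < x := (mul_pos (Abar_pos hα) (rpow_pos_of_pos hn0 _)).trans_le hx
  have hy : (1 + α) ^ ((1 + α) / α) * n ≤ x ^ (1 / α) := by
    rw [← Abar_rpow hα, ← mul_rpow_rpow_inv hα (Abar_pos hα).le]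
    exact rpow_le_rpow (mul_nonneg (Abar_pos hα).le (rpow_nonneg hn0.le _)) hx (by positivity)
  have hy1 : 1 * (n : ℝ) ≤ x ^ (1 / α) := by
    refine le_trans (mul_le_mul_of_nonneg_right ?_ hn0.le) hy
    exact one_le_rpow (by linarith) (by positivity)
  -- The factor `α^{-5/2}` is pure slack here.
  have hαp : 1 ≤ α ^ (-(5 / 2) : ℝ) := one_le_rpow_of_pos_of_le_one_of_nonpos hα hα1.le (by norm_num)
  have hxb : 0 < x ^ betaIdx α β := rpow_pos_of_pos hx0 _
  suffices hs : |W α β n x| ≤ max K₁ K₂ *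
      (x ^ betaIdx α β * exp (-η * x ^ (1 / α)) * exp (n * H α η)) by
    refine hs.trans (mul_le_mul_of_nonneg_left ?_ (by positivity))
    rw [mul_assoc, mul_assoc, mul_assoc]
    exact le_mul_of_one_le_left (by positivity) hαp
  by_cases hE : η ∈ E α
  · have hE' := mem_E_iff.1 hE
    have hη0 : 0 < η := (saddleAbscissa_pos hα).trans_le hE'.1
    have hm : 0 < η ^ (-α) - 1 := sub_pos.2 (one_lt_rpow_of_pos_of_lt_one_of_neg hη0 hη
      (by linarith))
    have := h₁ α hα hα1.le hβ η ⟨(exp_neg_one_le_saddleAbscissa hα).trans hE'.1, le_max_left _ _⟩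
      n x (η ^ (-α) - 1) hx0 hy1 (neg_log_mul_le hα hη0 (le_max_left _ _))
      fun v hv => sub_one_le_gap hα hα1.le hη0 (rpow_neg_le_one_add hα hE'.1) hv
    rw [div_eq_mul_one_div, inv_pow_eq_exp hm, ← neg_mul] at this
    rw [H, if_pos hE]
    exact this.trans (mul_le_mul_of_nonneg_right (le_max_left _ _) (by positivity))
  · have hlt : η < saddleAbscissa α := by
      by_contra hcon
      exact hE (mem_E_iff.2 ⟨not_lt.1 hcon, hη⟩)
    refine (h₂ α hα hα1.le hβ n x hx0 hy1).trans ?_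
    refine mul_le_mul (le_max_right _ _) ?_ (by positivity) (by positivity)
    rw [H, if_neg hE, mul_assoc, mul_assoc, ← exp_add, ← exp_add, add_comm α 1]
    refine mul_le_mul_of_nonneg_left (exp_le_exp.2 ?_) hxb.le
    have h4 := mul_le_mul_of_nonneg_left hy (sub_nonneg.2 hlt.le)
    have h5 := rpow_mul_saddleAbscissa hα
    linear_combination h4 - n * h5

theorem half_Ico_subset_E (hα : 0 < α) (hα1 : α < 1) : Ico (1 / 2 : ℝ) 1 ⊆ E α := fun _ h =>
  mem_E_iff.2 ⟨(saddleAbscissa_le_half hα hα1.le).trans h.1, h.2⟩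

/-- Bernoulli for `z^{1+α}` at `z = η / saddleAbscissa α`, with equality at `z = 1`. -/
theorem mul_one_sub_rpow_le (hα : 0 < α) {η : ℝ} (hη : 0 < η) :
    η * (1 - η ^ α) * (1 + α) ^ ((1 + α) / α) ≤ α := by
  have hr := saddleAbscissa_pos hα
  have hz : 0 < η / saddleAbscissa α := by positivity
  have hb := one_add_mul_self_le_rpow_one_add (s := η / saddleAbscissa α - 1) (by linarith)
    (p := 1 + α) (by linarith)
  rw [add_sub_cancel, add_comm 1 α, rpow_add_one hz.ne', div_rpow hη.le hr.le] at hb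
  have h1 := rpow_mul_saddleAbscissa hα
  have h2 := saddleAbscissa_rpow_neg hα
  rw [rpow_neg hr.le] at h2
  rw [div_eq_mul_inv (η ^ α), h2] at hb
  have h3 : (1 + α) ^ ((1 + α) / α) = (1 + α) / saddleAbscissa α := by
    rw [eq_div_iff hr.ne', h1]
  rw [h3]
  have e : η * (1 - η ^ α) * ((1 + α) / saddleAbscissa α) =
      (1 + α) * (η / saddleAbscissa α) -
        η ^ α * (1 + α) * (η / saddleAbscissa α) := by ring
  rw [e]
  linarith

/-- The logarithmic term has derivative `α / (η (1 - η^α))`, which `mul_one_sub_rpow_le` shows to be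
at least the linear slope. -/
theorem neg_log_sub_linear_monotoneOn (hα : 0 < α) :
    MonotoneOn (fun η => -log (η ^ (-α) - 1) - η * (1 + α) ^ ((1 + α) / α)) (Ioo 0 1) := by
  have hpos : ∀ η ∈ Ioo (0 : ℝ) 1, 0 < η ^ (-α) - 1 := fun η h =>
    sub_pos.2 (one_lt_rpow_of_pos_of_lt_one_of_neg h.1 h.2 (by linarith))
  have hd : ∀ η ∈ Ioo (0 : ℝ) 1,
      HasDerivAt (fun η => -log (η ^ (-α) - 1) - η * (1 + α) ^ ((1 + α) / α))
        (-(-α * η ^ (-α - 1) / (η ^ (-α) - 1)) - 1 * (1 + α) ^ ((1 + α) / α)) η := by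
    intro η h
    exact ((((hasDerivAt_rpow_const (p := -α) (Or.inl h.1.ne')).sub_const 1).log
      (hpos η h).ne').neg).sub ((hasDerivAt_id η).mul_const _)
  refine monotoneOn_of_deriv_nonneg (convex_Ioo _ _)
    (fun η h => (hd η h).continuousAt.continuousWithinAt) ?_ ?_ <;> rw [interior_Ioo]
  · exact fun η h => (hd η h).differentiableAt.differentiableWithinAt
  · intro η h
    have h1 := hpos η h
    have h2 := mul_one_sub_rpow_le hα h.1
    have h0 := h.1
    have hpw : 0 < η ^ α := rpow_pos_of_pos h0 _
    rw [(hd η h).deriv, one_mul, sub_nonneg, neg_mul, neg_div, neg_neg, le_div_iff₀ h1,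
      rpow_sub_one h0.ne', rpow_neg h0.le, inv_eq_one_div]
    have e : (1 + α) ^ ((1 + α) / α) * (1 / η ^ α - 1) =
        η * (1 - η ^ α) * (1 + α) ^ ((1 + α) / α) * (1 / η ^ α / η) := by
      field_simp
    rw [e]
    exact mul_le_mul_of_nonneg_right h2 (by positivity)

/-- The two branches agree at `saddleAbscissa α`, and their difference is monotone, so the larger
one switches exactly there. -/
theorem H_eq_max (hα : 0 < α) (hα1 : α < 1) {η : ℝ} (hη : η ∈ Ioo (0 : ℝ) 1) :
    H α η = max (η * (1 + α) ^ ((α + 1) / α) - (α + 1) - log α) (-log (η ^ (-α) - 1)) := by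
  have hr := saddleAbscissa_pos hα
  have hr1 : saddleAbscissa α < 1 := by linarith [saddleAbscissa_le_half hα hα1.le]
  have hm := neg_log_sub_linear_monotoneOn hα
  have h1 := rpow_mul_saddleAbscissa hα
  rw [H]
  split_ifs with hE
  · have := hm ⟨hr, hr1⟩ hη (mem_E_iff.1 hE).1
    simp only [saddleAbscissa_rpow_neg hα, add_sub_cancel_left] at this
    rw [max_eq_right]
    rw [add_comm α 1]
    linarith
  · have hlt : η < saddleAbscissa α := by
      by_contra hcon
      exact hE (mem_E_iff.2 ⟨not_lt.1 hcon, hη.2⟩)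
    have := hm hη ⟨hr, hr1⟩ hlt.le
    simp only [saddleAbscissa_rpow_neg hα, add_sub_cancel_left] at this
    rw [max_eq_left]
    rw [add_comm α 1]
    linarith

/-- For `α < 1` the point `1/2` is interior to `E α`, so a single continuous branch of `H` is in
force nearby. -/
theorem H_tendsto_half (hα : 0 < α) (hα1 : α < 1) :
    Tendsto (H α) (𝓝[≠] (1 / 2)) (𝓝 (-log ((1 / 2) ^ (-α) - 1))) := by
  have hpos : (0 : ℝ) < (1 / 2) ^ (-α) - 1 :=
    sub_pos.2 (one_lt_rpow_of_pos_of_lt_one_of_neg (by norm_num) (by norm_num) (by linarith))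
  have hc : ContinuousAt (fun η : ℝ => -log (η ^ (-α) - 1)) (1 / 2) :=
    (((continuousAt_id.rpow_const (Or.inl (by norm_num))).sub continuousAt_const).log hpos.ne').neg
  refine (hc.tendsto.mono_left nhdsWithin_le_nhds).congr' ?_
  refine Filter.Eventually.filter_mono nhdsWithin_le_nhds ?_
  filter_upwards [Ioo_mem_nhds (saddleAbscissa_lt_half hα hα1) (by norm_num : (1 / 2 : ℝ) < 1)]
    with η h
  rw [H, if_pos (mem_E_iff.2 ⟨h.1.le, h.2⟩)]

theorem iterated_limit_H : Tendsto (fun α : ℝ => -log ((1 / 2 : ℝ) ^ (-α) - 1)) (𝓝[<] 1) (𝓝 0) := by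
  have hc : ContinuousAt (fun α : ℝ => -log ((1 / 2 : ℝ) ^ (-α) - 1)) 1 := by
    refine ContinuousAt.neg (ContinuousAt.log (ContinuousAt.sub ?_ continuousAt_const) ?_)
    · exact continuousAt_const.rpow continuousAt_neg (Or.inl (by norm_num))
    · rw [rpow_neg_one]; norm_num
  have := hc.tendsto
  simp only [rpow_neg_one] at this
  norm_num at this
  norm_num
  exact this.mono_left nhdsWithin_le_nhds

end Outer

/-! ### The bound along `x = κ̄_α(θ) n^α`. -/

section Saddle

/-- Here `σ` is chosen with `σ^{-α} = saddleRatio α θ`, so `m = sin(αθ)/sin θ`. It is exactly the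
base of the prefactor, and it stays in `[s₀, 1/2]`, so that prefactor is bounded below and goes into
the constant. -/
theorem exists_abs_W_le_saddle (β : ℝ) {α₀ θ₀ : ℝ} (hα₀ : α₀ ∈ Ioo (0 : ℝ) 1)
    (hθ₀ : θ₀ ∈ Ioo 0 (π / 2)) :
    ∃ K > 0, ∀ α ∈ Ioc α₀ 1, 1 - 1 / α ≤ β →
      ∀ θ ∈ Ioo 0 θ₀, ∀ n : ℕ, 1 ≤ n → ∀ x : ℝ, x = kappaBar α θ * (n : ℝ) ^ α →
        |W α β n x| ≤
          K * (cos θ * (sin θ / sin ((1 + α) * θ)) ^ (1 / α)) ^ (betaBar α β + 1 / 2) *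
            x ^ betaIdx α β *
            exp (n * (-(α * (sin ((1 + α) * θ) * cos θ / sin (α * θ))) +
              log (sin θ / sin (α * θ)))) := by
  have hp := Real.pi_pos
  have hc₀ : 0 < cos θ₀ := cos_pos_of_mem_Ico ⟨hθ₀.1.le, hθ₀.2⟩
  have hα₀0 := hα₀.1
  obtain ⟨s₀, hs₀⟩ : ∃ s₀, s₀ = cos θ₀ * exp (-1) := ⟨_, rfl⟩
  have hs₀0 : 0 < s₀ := hs₀ ▸ by positivity
  -- The constant `c` comes from `x^{1/α} = α S₁^{1/α} S₂ n`, where both sine quotients `S₁`, `S₂`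
  -- are at least `cos θ₀`.
  obtain ⟨K, hK, h⟩ := exists_abs_W_le β (s₀ := s₀) (η₁ := 1 / 2)
    (c := α₀ * cos θ₀ ^ (1 / α₀) * cos θ₀) (c' := 1) hs₀0 (by norm_num) (by positivity) one_pos
  refine ⟨K / s₀ ^ (|β| + 2), by positivity, fun α hα hβ θ hθ n hn x hx => ?_⟩
  have hα0 : 0 < α := hα₀0.trans hα.1
  have hα1 := hα.2
  have hn0 : (0 : ℝ) < n := by exact_mod_cast hn
  have hθ' : θ ∈ Ioo 0 (π / 2) := ⟨hθ.1, hθ.2.trans hθ₀.2⟩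
  have hc : 0 < cos θ := cos_pos_of_mem_Ico ⟨hθ.1.le, hθ'.2⟩
  have hcc : cos θ₀ ≤ cos θ :=
    (cos_lt_cos_of_nonneg_of_le_pi_div_two hθ.1.le hθ₀.2.le hθ.2).le
  have hs : 0 < sin θ := sin_pos_of_pos_of_lt_pi hθ.1 (by linarith [hθ'.2])
  have hsα : 0 < sin (α * θ) := sin_mul_pos hα0 hα1 hθ.1 hθ'.2.le
  have hst : 0 < sin ((1 + α) * θ) := sin_one_add_pos hα0 hα1 hθ.1 hθ'.2
  have hm : 1 * α ≤ sin (α * θ) / sin θ := by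
    rw [one_mul, le_div_iff₀ hs]
    exact mul_sin_le_sin_mul hα0.le hα1 hθ.1.le (by linarith [hθ'.2])
  have hsα1 : sin (α * θ) ≤ sin θ :=
    sin_le_sin_of_le_of_le_pi_div_two (by nlinarith [hθ.1]) hθ'.2.le (by nlinarith [hθ.1])
  have hκ : 0 < kappaBar α θ := by unfold kappaBar; positivity
  have hx0 : 0 < x := hx ▸ mul_pos hκ (rpow_pos_of_pos hn0 _)
  obtain ⟨σ, hσ⟩ : ∃ σ, σ = cos θ * (sin θ / sin ((1 + α) * θ)) ^ (1 / α) := ⟨_, rfl⟩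
  have hσ0 : 0 < σ := hσ ▸ by positivity
  have hσq : σ ^ (-α) = saddleRatio α θ := by
    rw [hσ, mul_rpow hc.le (by positivity), ← rpow_mul (by positivity),
      show 1 / α * -α = -1 by field_simp, rpow_neg_one, rpow_neg hc.le, saddleRatio]
    have := rpow_pos_of_pos hc α
    field_simp
  have hσr : σ ≤ saddleAbscissa α := by
    by_contra hcon
    have h1 := rpow_lt_rpow_of_neg (saddleAbscissa_pos hα0) (not_le.1 hcon) (neg_lt_zero.2 hα0)
    rw [saddleAbscissa_rpow_neg hα0, hσq] at h1
    exact absurd (one_add_le_saddleRatio hα0 hα1 hθ') (not_le.2 h1)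
  have hσs : s₀ ≤ σ := by
    rw [hs₀, hσ]
    refine mul_le_mul hcc ((exp_neg_one_le_saddleAbscissa hα0).trans ?_) (exp_pos _).le hc.le
    rw [saddleAbscissa, rpow_neg (by linarith), ← inv_rpow (by linarith), inv_eq_one_div]
    refine rpow_le_rpow (by positivity) ?_ (by positivity)
    rw [le_div_iff₀ hst]
    have := mul_sin_le_sin_mul (s := 1 / (1 + α)) (u := (1 + α) * θ) (by positivity)
      (by rw [div_le_one (by linarith)]; linarith) (by nlinarith [hθ.1]) (by nlinarith [hθ'.1, hθ'.2])
    rwa [show 1 / (1 + α) * ((1 + α) * θ) = θ by field_simp] at this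
  have hxy : x ^ (1 / α) = α * (sin ((1 + α) * θ) / sin θ) ^ (1 / α) *
      (sin ((1 + α) * θ) / sin (α * θ)) * n := by
    rw [hx, mul_rpow_rpow_inv hα0 hκ.le, kappaBar, mul_rpow (by positivity) (by positivity),
      mul_rpow (by positivity) (by positivity), ← rpow_mul hα0.le, ← rpow_mul (by positivity),
      mul_one_div_cancel hα0.ne', rpow_one, rpow_one]
  have hS1 : cos θ₀ ≤ sin ((1 + α) * θ) / sin θ := by
    have h1 := one_add_le_saddleRatio hα0 hα1 hθ'
    have h2 : cos θ ≤ cos θ ^ α := by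
      simpa using rpow_le_rpow_of_exponent_ge hc (cos_le_one θ) hα1
    rw [saddleRatio, ← div_div, le_div_iff₀ (by positivity)] at h1
    nlinarith
  have hS2 : cos θ₀ ≤ sin ((1 + α) * θ) / sin (α * θ) := by
    refine hS1.trans ?_
    gcongr
  have hy : α₀ * cos θ₀ ^ (1 / α₀) * cos θ₀ * n ≤ x ^ (1 / α) := by
    rw [hxy]
    have h1 : cos θ₀ ^ (1 / α₀) ≤ (sin ((1 + α) * θ) / sin θ) ^ (1 / α) :=
      (rpow_le_rpow_of_exponent_ge hc₀ (cos_le_one _)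
        (one_div_le_one_div_of_le hα₀0 hα.1.le)).trans
        (rpow_le_rpow hc₀.le hS1 (by positivity))
    have := hα.1.le
    gcongr
  have hW := h α hα0 hα1 hβ σ ⟨hσs, hσr.trans (saddleAbscissa_le_half hα0 hα1)⟩ n x _ hx0 hy hm
    fun v hv => saddle_le_gap hα0 hα1 hσ0 hθ' hσq hv
  rw [div_eq_mul_one_div, inv_pow_eq_exp (by positivity), ← log_inv, inv_div] at hW
  have hσx : σ * x ^ (1 / α) = n * (α * (sin ((1 + α) * θ) * cos θ / sin (α * θ))) := by
    have e : (sin θ / sin ((1 + α) * θ)) ^ (1 / α) * (sin ((1 + α) * θ) / sin θ) ^ (1 / α) = 1 := by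
      rw [← mul_rpow (by positivity) (by positivity), div_mul_div_cancel₀ hst.ne', div_self hs.ne',
        one_rpow]
    rw [hσ, hxy]
    linear_combination (cos θ * α * (sin ((1 + α) * θ) / sin (α * θ)) * n) * e
  have hexp : exp (-(σ * x ^ (1 / α))) * exp (n * log (sin θ / sin (α * θ))) =
      exp (n * (-(α * (sin ((1 + α) * θ) * cos θ / sin (α * θ))) +
        log (sin θ / sin (α * θ)))) := by
    rw [hσx, ← exp_add]
    congr 1
    ring
  rw [mul_assoc (x ^ betaIdx α β), hexp] at hW
  rw [← hσ]
  have hpre : s₀ ^ (|β| + 2) ≤ σ ^ (betaBar α β + 1 / 2) := by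
    have hαβ : α * β ≤ |β| := by
      calc α * β ≤ α * |β| := mul_le_mul_of_nonneg_left (le_abs_self β) hα0.le
        _ ≤ 1 * |β| := mul_le_mul_of_nonneg_right hα1 (abs_nonneg β)
        _ = |β| := one_mul _
    refine (rpow_le_rpow hs₀0.le hσs (by positivity)).trans
      (rpow_le_rpow_of_exponent_ge hσ0 ?_ ?_)
    · linarith [saddleAbscissa_le_half hα0 hα1]
    · unfold betaBar
      linarith
  have hxb : 0 < x ^ betaIdx α β := rpow_pos_of_pos hx0 _
  refine hW.trans ?_
  rw [← mul_assoc]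
  refine mul_le_mul_of_nonneg_right (mul_le_mul_of_nonneg_right ?_ hxb.le) (exp_pos _).le
  rw [div_mul_eq_mul_div, le_div_iff₀ (by positivity)]
  exact mul_le_mul_of_nonneg_left hpre hK.le

end Saddle

/-! ### The bound valid for every positive `x`. -/

section Sector

theorem exists_rpow_le_mul_exp {δ σ : ℝ} (hδ : 0 < δ) (hσ : 0 < σ) :
    ∃ C > 0, ∀ y : ℝ, 0 ≤ y → y ^ δ ≤ C * exp (σ * y) := by
  refine ⟨(δ / σ) ^ δ, by positivity, fun y hy => ?_⟩
  have h : y ≤ δ / σ * exp (σ * y / δ) := by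
    have := add_one_le_exp (σ * y / δ)
    calc y = δ / σ * (σ * y / δ) := by field_simp
      _ ≤ _ := mul_le_mul_of_nonneg_left (by linarith) (by positivity)
  refine (rpow_le_rpow hy h hδ.le).trans (le_of_eq ?_)
  rw [mul_rpow (by positivity) (exp_pos _).le, ← exp_mul, div_mul_cancel₀ _ hδ.ne']

/-- The distance from `1` to a ray at angle `α |arg v| ≤ π/2` is the sine of that angle. -/
theorem sin_le_gap {α ψ : ℝ} (hα : 0 < α) (hα1 : α ≤ 1) (hψ : 0 ≤ ψ) {v : ℂ} (hv : 0 < v.re)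
    (h : ψ ≤ α * |v.arg|) : sin ψ ≤ gap α v := by
  have harg := abs_arg_mem hv
  have hle : α * |v.arg| ≤ π / 2 := by nlinarith [harg.1, harg.2]
  have h1 : sin ψ ≤ sin (α * |v.arg|) :=
    sin_le_sin_of_le_of_le_pi_div_two (by linarith [Real.pi_pos]) hle h
  refine h1.trans ((le_abs_self _).trans (abs_le_of_sq_le_sq ?_ (norm_nonneg _)))
  rw [gap_sq_line hv rfl, lineGapSq]
  have := sin_sq_add_cos_sq (α * |v.arg|)
  nlinarith [sq_nonneg (v.re ^ (-α) * cos |v.arg| ^ α - cos (α * |v.arg|))]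

/-- With `α` fixed and the gap at least `m` on all four sides, no comparison between sides is
needed, hence no relation between `x` and `n`. -/
theorem exists_abs_W_le_of_gap {α β σ T m : ℝ} (hα : 0 < α) (hα1 : α ≤ 1) (hβ : 1 - 1 / α ≤ β)
    (hσ : 0 < σ) (hσ1 : σ < 1) (hT : 0 < T) (hm : 0 < m)
    (hline : ∀ v : ℂ, v.re = σ → m ≤ gap α v) (hfar : ∀ v : ℂ, T ≤ ‖v‖ → m ≤ gap α v) :
    ∃ K > 0, ∀ (n : ℕ) (x : ℝ), 0 < x →
      |W α β n x| ≤ K * (x ^ betaIdx α β * exp (-(σ * x ^ (1 / α))) / m ^ n) := by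
  obtain ⟨Λ, hΛ⟩ : ∃ Λ, Λ = max (1 / σ) (T + 1 + T) := ⟨_, rfl⟩
  have hΛ1 : 1 / σ ≤ Λ := hΛ ▸ le_max_left _ _
  have hΛ2 : T + 1 + T ≤ Λ := hΛ ▸ le_max_right _ _
  have hΛ0 : 0 < Λ := by linarith
  have hG : 0 < Gamma (α * β + 1) := Gamma_pos_of_pos (gamma_arg_pos hα hβ)
  have hR : 0 < T + 1 - σ := by linarith
  refine ⟨α / Gamma (α * β + 1) * (Λ ^ |α * β - α| * (1 / m)) *
    (2 * (T + 1 - σ) + 4 * T) / (2 * π), by positivity, fun n x hx => ?_⟩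
  refine (abs_W_le_of_rect hα hα1 hβ hx (b := T + 1) (T := T)
    (M := Λ ^ |α * β - α| * (1 / m) * (exp (-(σ * x ^ (1 / α))) / m ^ n)) hσ hσ1 (by linarith) hT
    fun v h1 h2 h3 h4 => ?_).trans (le_of_eq (by ring))
  have hre : 0 < v.re := hσ.trans_le h1
  have hN : 0 < ‖v‖ := hre.trans_le (Complex.re_le_norm v)
  have hg : m ≤ gap α v := by
    rcases h4 with h | h | h
    · exact hline v h
    · exact hfar v (by linarith [Complex.re_le_norm v])
    · exact hfar v (h ▸ Complex.abs_im_le_norm v)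
  have b1 : ‖v‖ ^ (α * β - α) ≤ Λ ^ |α * β - α| := by
    refine rpow_le_rpow_of_bounds hN ?_ ?_ le_rfl
    · have := Complex.norm_le_abs_re_add_abs_im v
      rw [abs_of_pos hre] at this
      linarith
    · exact le_trans (one_div_le_one_div_of_le hσ (h1.trans (Complex.re_le_norm v))) hΛ1
  have b2 : exp (-(x ^ (1 / α) * v.re)) ≤ exp (-(σ * x ^ (1 / α))) := by
    refine exp_le_exp.2 ?_
    have := rpow_pos_of_pos hx (1 / α)
    nlinarith
  calc ‖v‖ ^ (α * β - α) * exp (-(x ^ (1 / α) * v.re)) / gap α v ^ (n + 1)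
      ≤ Λ ^ |α * β - α| * exp (-(σ * x ^ (1 / α))) / m ^ (n + 1) := by
        refine div_le_div₀ (by positivity) (mul_le_mul b1 b2 (exp_pos _).le (by positivity))
          (by positivity) (pow_le_pow_left₀ hm.le hg _)
    _ = _ := by
        rw [pow_succ]
        field_simp

/-- Working with `ε/2` leaves a spare geometric factor `(m/m₀)^n` that absorbs any power of `n`.
Since `a > -β_α`, the exponential absorbs `x^{β_α + a}`. -/
theorem exists_abs_W_le_sector {α β : ℝ} (hα : α ∈ Ioo (0 : ℝ) 1) (hβ : 1 - 1 / α ≤ β) {a : ℝ}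
    (ha : -betaIdx α β < a) {ε : ℝ} (hε : ε ∈ Ioo 0 α) :
    ∃ K > 0, ∀ n : ℕ, 1 ≤ n → ∀ x : ℝ, 0 < x →
      |W α β n x| ≤
        K * ((n : ℝ) ^ (3 / 2 - a) * (1 / sin ((α - ε) * (π / 2))) ^ n * x ^ (-a)) := by
  have hp := Real.pi_pos
  obtain ⟨hα0, hα1⟩ := hα
  obtain ⟨hε0, hεα⟩ := hε
  obtain ⟨m₀, hm₀⟩ : ∃ m₀, m₀ = sin ((α - ε) * (π / 2)) := ⟨_, rfl⟩
  obtain ⟨m, hm⟩ : ∃ m, m = sin ((α - ε / 2) * (π / 2)) := ⟨_, rfl⟩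
  have hm₀0 : 0 < m₀ := hm₀ ▸ sin_pos_of_pos_of_lt_pi (by nlinarith) (by nlinarith)
  have hm₀m : m₀ < m := by
    rw [hm, hm₀]
    exact sin_lt_sin_of_lt_of_le_pi_div_two (by nlinarith) (by nlinarith) (by nlinarith)
  have hm0 : 0 < m := hm₀0.trans hm₀m
  have hm1 : m < 1 := by
    rw [hm, ← sin_pi_div_two]
    exact sin_lt_sin_of_lt_of_le_pi_div_two (by nlinarith) le_rfl (by nlinarith)
  obtain ⟨φ, hφ⟩ : ∃ φ, φ = (α - ε / 2) * (π / 2) / α := ⟨_, rfl⟩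
  have hφα : α * φ = (α - ε / 2) * (π / 2) := by rw [hφ]; field_simp
  have hφ0 : 0 < φ := hφ ▸ div_pos (by nlinarith) hα0
  have hφ1 : φ < π / 2 := by
    rw [hφ, div_lt_iff₀ hα0]
    nlinarith
  have hcφ : 0 < cos φ := cos_pos_of_mem_Ico ⟨hφ0.le, hφ1⟩
  -- On the line `Re v = ρ cos φ`, an argument below `φ` forces `|v| ≤ ρ`, and then the gap is at
  -- least `ρ^{-α} - 1 = 1 > m`; larger arguments fall under `sin_le_gap`.
  obtain ⟨ρ, hρ⟩ : ∃ ρ : ℝ, ρ = 2 ^ (-(1 / α)) := ⟨_, rfl⟩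
  have hρ0 : 0 < ρ := hρ ▸ rpow_pos_of_pos two_pos _
  have hρ1 : ρ < 1 := hρ ▸ rpow_lt_one_of_one_lt_of_neg one_lt_two
    (neg_lt_zero.2 (by positivity))
  have hρα : ρ ^ (-α) = 2 := by
    rw [hρ, ← rpow_mul two_pos.le, show -(1 / α) * -α = 1 by field_simp, rpow_one]
  have hσ0 : 0 < cos φ * ρ := by positivity
  have hσ1 : cos φ * ρ < 1 := by nlinarith [cos_le_one φ]
  have hline : ∀ v : ℂ, v.re = cos φ * ρ → m ≤ gap α v := by
    intro v hv
    have hre : 0 < v.re := hv ▸ hσ0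
    have hv0 : v ≠ 0 := fun h => by simp [h] at hre
    have hN : 0 < ‖v‖ := norm_pos_iff.2 hv0
    rcases le_or_gt φ |v.arg| with h | h
    · rw [hm]
      exact sin_le_gap hα0 hα1.le (by nlinarith) hre (by rw [← hφα]; gcongr)
    · have h1 : cos φ < cos v.arg := by
        rw [← cos_abs v.arg]
        exact cos_lt_cos_of_nonneg_of_le_pi_div_two (abs_nonneg _) hφ1.le h
      rw [Complex.cos_arg hv0, hv, lt_div_iff₀ hN] at h1
      have h2 : ‖v‖ ≤ ρ := by
        by_contra hcon
        nlinarith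
      have h3 : ρ ^ (-α) ≤ ‖v‖ ^ (-α) := rpow_le_rpow_of_nonpos hN h2 (by linarith)
      have h4 : ‖v‖ ^ (-α) - 1 ≤ gap α v := by
        have := norm_sub_norm_le (v ^ ((-α : ℝ) : ℂ)) 1
        rwa [norm_one, Complex.norm_cpow_real, norm_sub_rev] at this
      linarith
  obtain ⟨T, hT⟩ : ∃ T, T = (1 - m) ^ (-(1 / α)) := ⟨_, rfl⟩
  have hT0 : 0 < T := hT ▸ rpow_pos_of_pos (by linarith) _
  have hTα : T ^ (-α) = 1 - m := by
    rw [hT, ← rpow_mul (by linarith), show -(1 / α) * -α = 1 by field_simp, rpow_one]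
  have hfar : ∀ v : ℂ, T ≤ ‖v‖ → m ≤ gap α v := by
    intro v hv
    have h1 : ‖v‖ ^ (-α) ≤ T ^ (-α) := rpow_le_rpow_of_nonpos hT0 hv (by linarith)
    have := one_sub_le_gap (α := α) (v := v)
    linarith
  obtain ⟨K, hK, hW⟩ := exists_abs_W_le_of_gap hα0 hα1.le hβ hσ0 hσ1 hT0 hm0 hline hfar
  obtain ⟨C₁, hC₁, h₁⟩ := exists_rpow_le_mul_exp (δ := α * (betaIdx α β + a))
    (mul_pos hα0 (by linarith)) hσ0
  -- The maximum with `1` keeps the exponent positive, whatever the sign of `a - 3/2`.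
  obtain ⟨C₂, hC₂, h₂⟩ := exists_rpow_le_mul_exp (δ := max (a - 3 / 2) 1) (σ := log (m / m₀))
    (by positivity) (log_pos ((one_lt_div hm₀0).2 hm₀m))
  refine ⟨K * C₁ * C₂, by positivity, fun n hn x hx => (hW n x hx).trans ?_⟩
  have hn1 : (1 : ℝ) ≤ n := by exact_mod_cast hn
  have hn0 : (0 : ℝ) < n := by linarith
  have hy := rpow_pos_of_pos hx (1 / α)
  have hxa : 0 < x ^ (-a) := rpow_pos_of_pos hx _
  have e1 : x ^ betaIdx α β * exp (-(cos φ * ρ * x ^ (1 / α))) ≤ C₁ * x ^ (-a) := by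
    have h := h₁ (x ^ (1 / α)) hy.le
    rw [← rpow_mul hx.le, show 1 / α * (α * (betaIdx α β + a)) = betaIdx α β + a by field_simp] at h
    have e : x ^ betaIdx α β = x ^ (betaIdx α β + a) * x ^ (-a) := by
      rw [← rpow_add hx]
      congr 1
      ring
    calc x ^ betaIdx α β * exp (-(cos φ * ρ * x ^ (1 / α)))
        = x ^ (betaIdx α β + a) * (x ^ (-a) * exp (-(cos φ * ρ * x ^ (1 / α)))) := by
          rw [e]; ring
      _ ≤ C₁ * exp (cos φ * ρ * x ^ (1 / α)) *
          (x ^ (-a) * exp (-(cos φ * ρ * x ^ (1 / α)))) :=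
          mul_le_mul_of_nonneg_right h (by positivity)
      _ = C₁ * x ^ (-a) := by
          rw [exp_neg]
          field_simp
  have e2 : 1 / m ^ n ≤ C₂ * ((n : ℝ) ^ (3 / 2 - a) * (1 / m₀) ^ n) := by
    have h := h₂ n hn0.le
    have h3 : (n : ℝ) ^ (a - 3 / 2) ≤ (n : ℝ) ^ max (a - 3 / 2) 1 :=
      rpow_le_rpow_of_exponent_le hn1 (le_max_left _ _)
    rw [mul_comm (log _), exp_nat_mul, exp_log (by positivity)] at h
    have h4 := h3.trans h
    have e : (n : ℝ) ^ (a - 3 / 2) = 1 / (n : ℝ) ^ (3 / 2 - a) := by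
      rw [← neg_sub, rpow_neg hn0.le, one_div]
    have hnp : 0 < (n : ℝ) ^ (3 / 2 - a) := rpow_pos_of_pos hn0 _
    rw [e, div_pow, div_le_iff₀ hnp] at h4
    rw [div_pow, one_pow, div_le_iff₀ (by positivity)]
    refine h4.trans (le_of_eq (by ring))
  rw [← hm₀]
  calc K * (x ^ betaIdx α β * exp (-(cos φ * ρ * x ^ (1 / α))) / m ^ n)
      = K * (x ^ betaIdx α β * exp (-(cos φ * ρ * x ^ (1 / α))) * (1 / m ^ n)) := by ring
    _ ≤ K * (C₁ * x ^ (-a) * (C₂ * ((n : ℝ) ^ (3 / 2 - a) * (1 / m₀) ^ n))) := by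
        gcongr
    _ = _ := by ring

end Sector

end GaussLaguerre

end

/-! ### Assembly of the statements. -/

theorem mainTheorem6 (β : ℝ) :
    -- ordering of the three constants
    (∀ α ∈ Ioc (0 : ℝ) 1,
      GaussLaguerre.Cbar α ≤ GaussLaguerre.Bbar α ∧
      GaussLaguerre.Bbar α ≤ GaussLaguerre.Abar α) ∧
    -- (1) bound on a vertical line, uniform in `x > 0`
    (∀ α ∈ Ioo (0 : ℝ) 1, 1 - 1 / α ≤ β →
      ∀ a : ℝ, -GaussLaguerre.betaIdx α β < a → ∀ ε ∈ Ioo 0 α,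
        ∃ K > 0, ∃ n₀ : ℕ, 1 ≤ n₀ ∧ ∀ n : ℕ, n₀ ≤ n → ∀ x : ℝ, 0 < x →
          |GaussLaguerre.W α β n x| ≤
            K * ((n : ℝ) ^ (3 / 2 - a) * (1 / sin ((α - ε) * (π / 2))) ^ n * x ^ (-a))) ∧
    -- (2) the parametrisation `κ̄_α` and the bound at `x = κ̄_α(θ) n^α`
    ((∀ α ∈ Ioc (0 : ℝ) 1,
        StrictAntiOn (GaussLaguerre.kappaBar α) (Ioc 0 (π / 2)) ∧
        Tendsto (GaussLaguerre.kappaBar α) (𝓝[>] 0) (𝓝 (GaussLaguerre.Abar α)) ∧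
        GaussLaguerre.kappaBar α (π / (2 * (1 + α))) = GaussLaguerre.Bbar α ∧
        GaussLaguerre.kappaBar α (π / 2) = GaussLaguerre.Cbar α) ∧
      (∀ α₀ ∈ Ioo (0 : ℝ) 1, ∀ θ₀ ∈ Ioo 0 (π / 2),
        ∃ K > 0, ∀ α ∈ Ioc α₀ 1, 1 - 1 / α ≤ β →
          ∀ θ ∈ Ioo 0 θ₀, ∀ n : ℕ, 1 ≤ n → ∀ x : ℝ,
            x = GaussLaguerre.kappaBar α θ * (n : ℝ) ^ α →
            |GaussLaguerre.W α β n x| ≤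
              K * (cos θ * (sin θ / sin ((1 + α) * θ)) ^ (1 / α)) ^
                  (GaussLaguerre.betaBar α β + 1 / 2) *
                x ^ GaussLaguerre.betaIdx α β *
                exp (n * (-(α * (sin ((1 + α) * θ) * cos θ / sin (α * θ))) +
                  log (sin θ / sin (α * θ)))))) ∧
    -- (3) the middle range, in its two versions
    ((∀ α₀ ∈ Ioo (0 : ℝ) 1, ∀ ε > 0,
        ∃ n₀ : ℕ, 1 ≤ n₀ ∧ ∃ K > 0, ∀ α ∈ Icc α₀ 1, 1 - 1 / α ≤ β →
          ε < GaussLaguerre.Bbar α - GaussLaguerre.Cbar α →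
          ∀ n : ℕ, n₀ ≤ n →
          ∀ x ∈ Ioo ((GaussLaguerre.Cbar α + ε) * (n : ℝ) ^ α)
              (GaussLaguerre.Abar α * (n : ℝ) ^ α),
            |GaussLaguerre.W α β n x| ≤
              K * (x ^ GaussLaguerre.betaIdx α β * exp (-(1 / 2) * x ^ (1 / α)) *
                exp (n * (-log α + 1 / 2 * (1 + α) ^ ((1 + α) / α) - 1 - α)))) ∧
      (∃ n₀ : ℕ, 1 ≤ n₀ ∧ ∃ K > 0, ∀ α ∈ Ioc (0 : ℝ) 1, 1 - 1 / α ≤ β →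
        ∀ n : ℕ, n₀ ≤ n →
        ∀ x ∈ Ioo (GaussLaguerre.Bbar α * (n : ℝ) ^ α)
            (GaussLaguerre.Abar α * (n : ℝ) ^ α),
          |GaussLaguerre.W α β n x| ≤
            K * (x ^ GaussLaguerre.betaIdx α β * exp (-(1 / 2) * x ^ (1 / α)) *
              exp (n * (-log α + 1 / 2 * (1 + α) ^ ((1 + α) / α) - 1 - α))))) ∧
    -- (4) the outer range
    ((∀ η : ℝ, η < 1 →
        ∃ K > 0, ∀ α ∈ Ioo (0 : ℝ) 1, 1 - 1 / α ≤ β →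
          ∀ n : ℕ, 1 ≤ n → ∀ x : ℝ, GaussLaguerre.Abar α * (n : ℝ) ^ α ≤ x →
            |GaussLaguerre.W α β n x| ≤
              K * (α ^ (-(5 / 2) : ℝ) * x ^ GaussLaguerre.betaIdx α β *
                exp (-η * x ^ (1 / α)) * exp (n * GaussLaguerre.H α η))) ∧
      (∀ α ∈ Ioo (0 : ℝ) 1, Ico (1 / 2 : ℝ) 1 ⊆ GaussLaguerre.E α) ∧
      (∀ α ∈ Ioo (0 : ℝ) 1, ∀ η ∈ Ioo (0 : ℝ) 1,
        GaussLaguerre.H α η =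
          max (η * (1 + α) ^ ((α + 1) / α) - (α + 1) - log α)
            (-log (η ^ (-α) - 1))) ∧
      (∃ L : ℝ → ℝ,
        (∀ α ∈ Ioo (0 : ℝ) 1, Tendsto (GaussLaguerre.H α) (𝓝[≠] (1 / 2)) (𝓝 (L α))) ∧
        Tendsto L (𝓝[<] 1) (𝓝 0))) := by
  refine ⟨fun α hα => ⟨GaussLaguerre.Cbar_le_Bbar hα.1 hα.2,
    GaussLaguerre.Bbar_le_Abar hα.1 hα.2⟩, ?_, ⟨?_, ?_⟩, ⟨?_, ?_⟩, ?_, ?_, ?_, ?_⟩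
  · intro α hα hβ a ha ε hε
    obtain ⟨K, hK, h⟩ := GaussLaguerre.exists_abs_W_le_sector hα hβ ha hε
    exact ⟨K, hK, 1, le_rfl, h⟩
  · exact fun α hα => ⟨GaussLaguerre.kappaBar_strictAntiOn hα.1 hα.2,
      GaussLaguerre.kappaBar_tendsto hα.1, GaussLaguerre.kappaBar_quarter hα.1 hα.2,
      GaussLaguerre.kappaBar_half_pi hα.1 hα.2⟩
  · exact fun α₀ hα₀ θ₀ hθ₀ => GaussLaguerre.exists_abs_W_le_saddle β hα₀ hθ₀
  · intro α₀ hα₀ ε hε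
    have hmin : 0 < min ε 1 := lt_min hε one_pos
    have hα₀0 := hα₀.1
    -- Since `C̄_α ≥ 0`, `x ≥ ε n^α`. The base is capped at `1` so that `1/α ≤ 1/α₀` yields a lower
    -- bound for `ε^{1/α}` uniform in `α`.
    obtain ⟨K, hK, h⟩ := GaussLaguerre.exists_abs_W_le_middle β
      (c := (min ε 1) ^ (1 / α₀)) (rpow_pos_of_pos hmin _)
    refine ⟨1, le_rfl, K, hK, fun α hα hβ _ n hn x hx => ?_⟩
    have hα0 : 0 < α := hα₀0.trans_le hα.1
    have hn0 : (0 : ℝ) < n := by exact_mod_cast hn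
    have hnα : 0 < (n : ℝ) ^ α := rpow_pos_of_pos hn0 _
    have hC : 0 ≤ GaussLaguerre.Cbar α := by
      rw [← GaussLaguerre.kappaBar_half_pi hα0 hα.2]
      have hs := GaussLaguerre.sin_mul_pos (θ := π / 2) hα0 hα.2 (by positivity) le_rfl
      have ht : 0 ≤ sin ((1 + α) * (π / 2)) :=
        sin_nonneg_of_nonneg_of_le_pi (by positivity) (by nlinarith [Real.pi_pos, hα.2])
      unfold GaussLaguerre.kappaBar
      rw [sin_pi_div_two]
      positivity
    have hle : ε * (n : ℝ) ^ α ≤ x := by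
      refine le_trans ?_ hx.1.le
      gcongr
      linarith
    refine h α hα0 hα.2 hβ n x ((mul_pos hε hnα).trans_le hle) ?_ hx.2
    calc min ε 1 ^ (1 / α₀) * (n : ℝ) ≤ ε ^ (1 / α) * n := by
          refine mul_le_mul_of_nonneg_right ?_ hn0.le
          exact (rpow_le_rpow_of_exponent_ge hmin (min_le_right _ _)
            (one_div_le_one_div_of_le hα₀0 hα.1)).trans
            (rpow_le_rpow hmin.le (min_le_left _ _) (by positivity))
      _ = (ε * (n : ℝ) ^ α) ^ (1 / α) := (GaussLaguerre.mul_rpow_rpow_inv hα0 hε.le n).symm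
      _ ≤ x ^ (1 / α) := rpow_le_rpow (by positivity) hle (by positivity)
  · obtain ⟨K, hK, h⟩ := GaussLaguerre.exists_abs_W_le_middle β (c := 2 / π) (by positivity)
    refine ⟨1, le_rfl, K, hK, fun α hα hβ n hn x hx => ?_⟩
    have hα0 : 0 < α := hα.1
    have hn0 : (0 : ℝ) < n := by exact_mod_cast hn
    have hnα : 0 < (n : ℝ) ^ α := rpow_pos_of_pos hn0 _
    have hle : (2 / π) ^ α * (n : ℝ) ^ α ≤ x :=
      (mul_le_mul_of_nonneg_right (GaussLaguerre.two_div_pi_rpow_le_Bbar hα0) hnα.le).trans hx.1.le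
    refine h α hα0 hα.2 hβ n x (lt_of_lt_of_le (by positivity) hle) ?_ hx.2
    calc 2 / π * (n : ℝ) = ((2 / π) ^ α * (n : ℝ) ^ α) ^ (1 / α) := by
          rw [GaussLaguerre.mul_rpow_rpow_inv hα0 (by positivity), ← rpow_mul (by positivity),
            mul_one_div_cancel hα0.ne', rpow_one]
      _ ≤ x ^ (1 / α) := rpow_le_rpow (by positivity) hle (by positivity)
  · exact fun η hη => GaussLaguerre.exists_abs_W_le_outer β hη
  · exact fun α hα => GaussLaguerre.half_Ico_subset_E hα.1 hα.2
  · exact fun α hα η hη => GaussLaguerre.H_eq_max hα.1 hα.2 hη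
  · exact ⟨fun α => -log ((1 / 2) ^ (-α) - 1),
      fun α hα => GaussLaguerre.H_tendsto_half hα.1 hα.2, GaussLaguerre.iterated_limit_H⟩
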